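/- Let $d\ge 1$ and let $\Omega=\mathcal P^{\mathbb Z^d}$, where $\mathcal P$ is the set of probability vectors on $\mathbb Z^d$, with its product $\sigma$-field $\mathfrak S$. Write $\omega=(\omega_x)_{x\in\mathbb Z^d}$ for an element of $\Omega$, $\pi_{x,y}(\omega)=\omega_{x,y-x}$ and $(T_z\omega)_x=\omega_{x+z}$. For a fixed environment $\omega$ let $P_z^\omega$ be the law on $(\mathbb Z^d)^{\mathbb N}$ of the Markov chain $(X_n)_{n\ge0}$ started at $z$ with transition probabilities $\pi_{x,y}(\omega)$. Let $\Pi(\omega,A)=P_0^\omega(T_{X_1}\omega\in A)$ be the transition kernel of the environment process. Fix $\hat u\in\mathbb Z^d\setminus\{0\}$ and put $\mathfrak S_\ell=\sigma\{\omega_x: x\cdot\hat u\ge \ell\}$. A probability measure $\mu$ on $\Omega$ satisfies (N) if there is $\delta>0$ with $\sum_z (z\cdot\hat u)\,\pi_{0,z}(\omega)\ge\delta$ for $\mu$-a.e. $\omega$; (M) if there are $M,s_0>0$ with $\sum_z e^{s_0|z|}\pi_{0,z}(\omega)\le e^{s_0M}$ for $\mu$-a.e. $\omega$. Let $\mathbb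 P$ be a probability measure on $\Omega$ under which the vectors $(\omega_x)_{x\in\mathbb Z^d}$ are i.i.d. and which satisfies (N) and (M). Let $\mathbb P_\infty$ be a probability measure on $\Omega$ that is invariant and ergodic for $\Pi$, satisfies (N) and (M), and is exponentially close to $\mathbb P$ in the direction $\hat u$: there are constants $0<c,C<\infty$ such that $$\sup_{A\in\mathfrak S_\ell}\{\mathbb P_\infty(A)-\mathbb P(A)\}\le Ce^{-c\ell}\qquad\text{for all integers }\ell\ge0 .$$ Let $v\in\mathbb R^d$ (for instance, the limiting velocity of the walk), let $B_n(t)=n^{-1/2}\bigl(X_{[nt]}-[nt]v\bigr)$ for $t\ge 0$, and let $Q_n^\omega=P_0^\omega(B_n\in\cdot\,)$ be the quenched distribution of $B_n$ on the Skorohod space $D_{\mathbb R^d}[0,\infty)$. Let $\mathfrak D$ be a symmetric, non-negative definite $d\times d$ matrix and let $W$ be the distribution on $D_{\mathbb R^d}[0,\infty)$ of the Brownian motion started at $0$ with diffusion matrix $\mathfrak D$, that is, the process with continuous paths and independent increments whose increment over $[s,t]$ is Gaussian with mean $0$ and covariance matrix $(t-s)\mathfrak D$. If $Q_n^\omega\Rightarrow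 W$ weakly on $D_{\mathbb R^d}[0,\infty)$ as $n\to\infty$ for $\mathbb P_\infty$-almost every $\omega$, then $Q_n^\omega\Rightarrow W$ weakly as $n\to\infty$ for $\mathbb P$-almost every $\omega$. -/

import Mathlib

open MeasureTheory ProbabilityTheory Filter Topology
open scoped ENNReal NNReal Matrix

namespace RWRE

/-! ### Environments -/

/-- The lattice `ℤ^d`. -/
abbrev Site (d : ℕ) : Type := Fin d → ℤ

/-- The space `ℝ^d` with its Euclidean norm. -/
abbrev Space (d : ℕ) : Type := EuclideanSpace ℝ (Fin d)

/-- The inclusion of `ℤ^d` in `ℝ^d`. -/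
noncomputable def toSpace {d : ℕ} (z : Site d) : Space d :=
  WithLp.toLp 2 (fun i => (z i : ℝ))

/-- The simplex of probability vectors on `ℤ^d`. -/
abbrev StepLaw (d : ℕ) : Type := PMF (Site d)

/-- The `σ`-algebra on probability vectors generated by the coordinates `p ↦ p z`. -/
instance stepLawMeasurableSpace (d : ℕ) : MeasurableSpace (StepLaw d) :=
  MeasurableSpace.comap (fun (p : StepLaw d) (z : Site d) => p z) MeasurableSpace.pi

/-- An environment `ω = (ω_x)`: a probability vector at every site. It carries the product
`σ`-algebra. The transition probability is `π_{x,y}(ω) = ω x (y - x)`. -/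
abbrev Env (d : ℕ) : Type := Site d → StepLaw d

/-- The shift `T_z`, that is `(T_z ω)_x = ω_{x+z}`. -/
def shift {d : ℕ} (z : Site d) (ω : Env d) : Env d := fun x => ω (x + z)

/-- The environment vectors `(ω_x)` are i.i.d. under `P`. -/
def IsIIDProduct {d : ℕ} (P : Measure (Env d)) : Prop :=
  ∃ μ : Measure (StepLaw d), ∃ _ : IsProbabilityMeasure μ,
    P = Measure.infinitePi (fun _ : Site d => μ)

/-- Non-nestling in direction `u`: for some `δ > 0`, `∑_z (z · u) π_{0,z} ≥ δ` almost surely.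
(If the series is not absolutely summable, then Lean's sum is `0` and the inequality fails.) -/
def HypothesisN {d : ℕ} (u : Site d) (P : Measure (Env d)) : Prop :=
  ∃ δ : ℝ, 0 < δ ∧
    ∀ᵐ ω ∂P, δ ≤ ∑' z : Site d, ((z ⬝ᵥ u : ℤ) : ℝ) * (ω 0 z).toReal

/-- Exponential moments: for some `M, s₀ > 0`, `∑_z exp (s₀ |z|) π_{0,z} ≤ exp (s₀ M)`
almost surely. -/
def HypothesisM {d : ℕ} (P : Measure (Env d)) : Prop :=
  ∃ M s₀ : ℝ, 0 < M ∧ 0 < s₀ ∧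
    ∀ᵐ ω ∂P, ∑' z : Site d, ENNReal.ofReal (Real.exp (s₀ * ‖toSpace z‖)) * ω 0 z
      ≤ ENNReal.ofReal (Real.exp (s₀ * M))

/-! ### The environment process and its equilibrium -/

theorem measurable_shift {d : ℕ} (z : Site d) : Measurable (shift z : Env d → Env d) :=
  measurable_pi_lambda _ fun x => measurable_pi_apply (x + z)

theorem measurable_prob {d : ℕ} (z : Site d) : Measurable (fun p : StepLaw d => p z) :=
  (measurable_pi_apply z).comp (comap_measurable (fun (p : StepLaw d) (z : Site d) => p z))

/-- The transition kernel `Π(ω, ·)` of the environment process: the law of `T_{X_1} ω` when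
`X_1` has distribution `π_{0,·}(ω)`, i.e. `Π(ω, A) = ∑_z π_{0,z}(ω) 1{T_z ω ∈ A}`. -/
noncomputable def envKernel (d : ℕ) : Kernel (Env d) (Env d) where
  toFun ω := (ω 0).toMeasure.map (fun z => shift z ω)
  measurable' := by
    classical
    refine Measure.measurable_of_measurable_coe _ fun A hA => ?_
    have h : (fun ω : Env d => ((ω 0).toMeasure.map (fun z => shift z ω)) A)
        = fun ω => ∑' z : Site d, if shift z ω ∈ A then ω 0 z else 0 := by
      funext ω
      have hm : Measurable (fun z => shift z ω) := measurable_of_countable _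
      rw [Measure.map_apply hm hA, PMF.toMeasure_apply _ (hm hA)]
      rfl
    rw [h]
    refine Measurable.tsum fun z => Measurable.ite (measurable_shift z hA) ?_
      measurable_const
    exact (measurable_prob z).comp (measurable_pi_apply 0)

/-- `P` is ergodic for the Markov kernel `κ`: every measurable set `A` with `κ 1_A = 1_A`
`P`-almost surely has probability `0` or `1`. -/
def IsErgodicFor {d : ℕ} (κ : Kernel (Env d) (Env d)) (P : Measure (Env d)) : Prop :=
  ∀ A : Set (Env d), MeasurableSet A →
    (∀ᵐ ω ∂P, κ ω A = A.indicator (fun _ => (1 : ℝ≥0∞)) ω) → P A = 0 ∨ P A = 1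

/-- The `σ`-algebra `𝔖_ℓ` generated by the `ω_x` with `x · u ≥ ℓ`. -/
@[reducible] def futureSigma {d : ℕ} (u : Site d) (ℓ : ℤ) : MeasurableSpace (Env d) :=
  ⨆ x : {x : Site d // ℓ ≤ x ⬝ᵥ u},
    MeasurableSpace.comap (fun ω : Env d => ω x.1) inferInstance

/-- The variation distance `sup_{A ∈ 𝔪} (μ(A) - ν(A))` of the restrictions of two probability
measures to the `σ`-algebra `𝔪`. -/
noncomputable def varDist {Ω : Type*} [MeasurableSpace Ω] (μ ν : Measure Ω)
    (𝔪 : MeasurableSpace Ω) : ℝ :=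
  ⨆ A : {A : Set Ω // MeasurableSet[𝔪] A}, (μ.real A.1 - ν.real A.1)

/-- `Pinf` is an equilibrium of the environment process associated with `P`: a probability
measure that is invariant and ergodic for `Π`, is exponentially close to `P` on the
`σ`-algebras `𝔖_ℓ`, and satisfies hypotheses (N) and (M). -/
structure IsEquilibrium {d : ℕ} (u : Site d) (P Pinf : Measure (Env d)) : Prop where
  prob : IsProbabilityMeasure Pinf
  invariant : (envKernel d).Invariant Pinf
  ergodic : IsErgodicFor (envKernel d) Pinf
  variation : ∃ c C : ℝ, 0 < c ∧ 0 < C ∧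
    ∀ ℓ : ℕ, varDist Pinf P (futureSigma u ℓ) ≤ C * Real.exp (-c * ℓ)
  hypN : HypothesisN u Pinf
  hypM : HypothesisM Pinf

/-! ### The walk in a fixed environment -/

/-- The one-step kernel of the walk in environment `ω`: from `x` it goes to `x + z` with
probability `ω_{x,z}`. -/
noncomputable def stepKernel {d : ℕ} (ω : Env d) : Kernel (Site d) (Site d) :=
  Kernel.ofFunOfCountable fun x => (ω x).toMeasure.map (fun z => x + z)

instance stepKernelMarkov {d : ℕ} (ω : Env d) : IsMarkovKernel (stepKernel ω) :=
  ⟨fun _ => Measure.isProbabilityMeasure_map (measurable_of_countable _).aemeasurable⟩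

/-- The next-step kernel given the history `(X_0, …, X_n)`; it depends on `X_n` only. -/
noncomputable def historyKernel {d : ℕ} (ω : Env d) (n : ℕ) :
    Kernel (Finset.Iic n → Site d) (Site d) :=
  (stepKernel ω).comap (fun h => h ⟨n, Finset.mem_Iic.2 le_rfl⟩) (measurable_pi_apply _)

instance historyKernelMarkov {d : ℕ} (ω : Env d) (n : ℕ) :
    IsMarkovKernel (historyKernel ω n) := by
  unfold historyKernel; infer_instance

/-- The quenched path measure `P_z^ω` on `(ℤ^d)^ℕ`: the law of the Markov chain with kernel
`stepKernel ω` started at `z`. -/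
noncomputable def quenchedLaw {d : ℕ} (ω : Env d) (z : Site d) :
    ProbabilityMeasure (ℕ → Site d) :=
  ⟨Kernel.traj (X := fun _ => Site d) (historyKernel ω) 0 (fun _ => z), inferInstance⟩

/-! ### The Skorohod space -/

/-- Right-continuous with left limits. -/
def IsCadlag {d : ℕ} (f : ℝ≥0 → Space d) : Prop :=
  ∀ t, ContinuousWithinAt f (Set.Ici t) t ∧ ∃ l, Tendsto f (𝓝[<] t) (𝓝 l)

/-- The space `D_{ℝ^d}[0,∞)` of cadlag paths. -/
def SkorohodSpace (d : ℕ) : Type := {f : ℝ≥0 → Space d // IsCadlag f}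

instance {d : ℕ} : CoeFun (SkorohodSpace d) (fun _ => ℝ≥0 → Space d) := ⟨Subtype.val⟩

/-- The basic Skorohod neighbourhood of `f`: the paths `g` such that, for some time change `τ`
(an increasing bijection of `[0,∞)`), `|τ(t) - t| < ε` and `|g(t) - f(τ(t))| < ε` for all
`t ≤ T`. -/
def skorohodNhd {d : ℕ} (f : SkorohodSpace d) (T : ℝ≥0) (ε : ℝ) : Set (SkorohodSpace d) :=
  {g | ∃ τ : ℝ≥0 ≃o ℝ≥0, ∀ t ≤ T, dist (τ t) t < ε ∧ dist (g t) (f (τ t)) < ε}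

theorem skorohodNhd_mono {d : ℕ} (f : SkorohodSpace d) {T T' : ℝ≥0} {ε ε' : ℝ}
    (hT : T' ≤ T) (hε : ε ≤ ε') : skorohodNhd f T ε ⊆ skorohodNhd f T' ε' := by
  rintro g ⟨τ, h⟩
  exact ⟨τ, fun t ht => ⟨(h t (ht.trans hT)).1.trans_le hε, (h t (ht.trans hT)).2.trans_le hε⟩⟩

/-- The Skorohod (`J₁`) topology on `D_{ℝ^d}[0,∞)`. It is the topology in which `f_n → f` iff
for every `T` there are time changes `τ_n` with `sup_{t ≤ T} |τ_n(t) - t| → 0` and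
`sup_{t ≤ T} |f_n(t) - f(τ_n(t))| → 0`. -/
instance skorohodTopology (d : ℕ) : TopologicalSpace (SkorohodSpace d) where
  IsOpen U := ∀ f ∈ U, ∃ T : ℝ≥0, ∃ ε : ℝ, 0 < ε ∧ skorohodNhd f T ε ⊆ U
  isOpen_univ := fun _ _ => ⟨0, 1, one_pos, Set.subset_univ _⟩
  isOpen_inter := by
    rintro U V hU hV f ⟨hfU, hfV⟩
    obtain ⟨T, ε, hε, h⟩ := hU f hfU
    obtain ⟨T', ε', hε', h'⟩ := hV f hfV
    exact ⟨max T T', min ε ε', lt_min hε hε', Set.subset_inter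
      ((skorohodNhd_mono f (le_max_left _ _) (min_le_left _ _)).trans h)
      ((skorohodNhd_mono f (le_max_right _ _) (min_le_right _ _)).trans h')⟩
  isOpen_sUnion := by
    rintro S hS f ⟨U, hU, hf⟩
    obtain ⟨T, ε, hε, h⟩ := hS U hU f hf
    exact ⟨T, ε, hε, h.trans (Set.subset_sUnion_of_mem hU)⟩

/-- The Borel `σ`-algebra of the Skorohod topology. -/
instance skorohodMeasurableSpace (d : ℕ) : MeasurableSpace (SkorohodSpace d) := borel _

instance skorohodBorelSpace (d : ℕ) : BorelSpace (SkorohodSpace d) := ⟨rfl⟩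

/-! ### The scaled walk and its quenched law -/

/-- The formula `t ↦ (X_{[nt]} - [nt] v) / √n`. -/
noncomputable def scaledFun {d : ℕ} (v : Space d) (n : ℕ) (X : ℕ → Site d) (t : ℝ≥0) :
    Space d :=
  (Real.sqrt n)⁻¹ • (toSpace (X ⌊(n : ℝ≥0) * t⌋₊) - (⌊(n : ℝ≥0) * t⌋₊ : ℝ) • v)

theorem isCadlag_scaledFun {d : ℕ} (v : Space d) (n : ℕ) (X : ℕ → Site d) :
    IsCadlag (scaledFun v n X) := by
  have hg : ∀ m : ℕ, Tendsto (fun k : ℕ => (Real.sqrt n)⁻¹ • (toSpace (X k) - (k : ℝ) • v))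
      (𝓝 m) (𝓝 ((Real.sqrt n)⁻¹ • (toSpace (X m) - (m : ℝ) • v))) := fun m =>
    (continuous_of_discreteTopology (f := fun k : ℕ =>
      (Real.sqrt n)⁻¹ • (toSpace (X k) - (k : ℝ) • v))).tendsto m
  intro t
  constructor
  · refine (hg ⌊(n : ℝ≥0) * t⌋₊).comp ?_
    rw [nhds_discrete]
    refine Filter.tendsto_pure.2 ?_
    have hlt : (n : ℝ≥0) * t < ⌊(n : ℝ≥0) * t⌋₊ + 1 := Nat.lt_floor_add_one _
    have hc : Tendsto (fun s : ℝ≥0 => (n : ℝ≥0) * s) (𝓝[Set.Ici t] t) (𝓝 ((n : ℝ≥0) * t)) :=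
      ((continuous_const.mul continuous_id).tendsto t).mono_left nhdsWithin_le_nhds
    filter_upwards [hc.eventually (gt_mem_nhds hlt), self_mem_nhdsWithin] with s hs hts
    refine le_antisymm ?_ (Nat.floor_le_floor (mul_le_mul_right hts _))
    exact Nat.lt_succ_iff.1 ((Nat.floor_lt zero_le).2 (by exact_mod_cast hs))
  · have hmono : Monotone (fun s : ℝ≥0 => ⌊(n : ℝ≥0) * s⌋₊) := fun s s' h =>
      Nat.floor_le_floor (mul_le_mul_right h _)
    exact ⟨_, (hg _).comp (hmono.tendsto_nhdsLT t)⟩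

/-- The process `B_n(t) = (X_{[nt]} - [nt] v) / √n` as a cadlag path. -/
noncomputable def scaledPath {d : ℕ} (v : Space d) (n : ℕ) (X : ℕ → Site d) :
    SkorohodSpace d :=
  ⟨scaledFun v n X, isCadlag_scaledFun v n X⟩

theorem continuous_scaledPath {d : ℕ} (v : Space d) (n : ℕ) :
    Continuous (scaledPath v n : (ℕ → Site d) → SkorohodSpace d) := by
  refine continuous_def.2 fun U hU => isOpen_iff_mem_nhds.2 fun X hX => ?_
  obtain ⟨T, ε, hε, hsub⟩ := hU (scaledPath v n X) hX
  have hev : ∀ᶠ Y in 𝓝 X, ∀ i ∈ Finset.range (⌊(n : ℝ≥0) * T⌋₊ + 1), Y i = X i := by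
    refine (Filter.eventually_all_finset _).2 fun i _ => ?_
    have : Tendsto (fun Y : ℕ → Site d => Y i) (𝓝 X) (𝓝 (X i)) :=
      (continuous_apply i).tendsto X
    rw [nhds_discrete (Site d)] at this
    exact Filter.tendsto_pure.1 this
  filter_upwards [hev] with Y hY
  refine hsub ⟨OrderIso.refl _, fun t ht => ?_⟩
  have hi : ⌊(n : ℝ≥0) * t⌋₊ ∈ Finset.range (⌊(n : ℝ≥0) * T⌋₊ + 1) :=
    Finset.mem_range.2 (Nat.lt_succ_iff.2 (Nat.floor_le_floor (mul_le_mul_right ht _)))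
  have he : scaledPath v n Y t = scaledPath v n X t := by
    change scaledFun v n Y t = scaledFun v n X t
    unfold scaledFun
    rw [hY _ hi]
  simp [he, hε]

/-- The quenched distribution `Q_n^ω = P_0^ω(B_n ∈ ·)` on `D_{ℝ^d}[0,∞)`. -/
noncomputable def quenchedScaledLaw {d : ℕ} (v : Space d) (n : ℕ) (ω : Env d) :
    ProbabilityMeasure (SkorohodSpace d) :=
  (quenchedLaw ω 0).map (f := scaledPath v n) (continuous_scaledPath v n).measurable.aemeasurable

/-! ### Brownian motion -/

/-- `W` is the distribution on `D_{ℝ^d}[0,∞)` of the Brownian motion (started at `0`) with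
diffusion matrix `𝔇`. -/
structure IsBrownianLaw {d : ℕ} (𝔇 : Matrix (Fin d) (Fin d) ℝ)
    (W : Measure (SkorohodSpace d)) : Prop where
  start : ∀ᵐ f : SkorohodSpace d ∂W, f 0 = 0
  continuous_paths : ∀ᵐ f : SkorohodSpace d ∂W, Continuous f.1
  indep_increments : HasIndepIncrements (fun (t : ℝ≥0) (f : SkorohodSpace d) => f t) W
  gaussian_increments : ∀ s t : ℝ≥0, s < t →
    HasLaw (fun f : SkorohodSpace d => f t - f s)
      (multivariateGaussian 0 (((t : ℝ) - (s : ℝ)) • 𝔇)) W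

end RWRE

namespace RWRE

/-! Weak convergence of the quenched laws depends on the whole environment, whereas `Pinf` and `P`
are comparable only far out in direction `u`. The proof replaces convergence by an event that
involves one half-space, and then transfers that event.

Since `W` lives on continuous paths, countably many test functions detect convergence to it. Let `G`
(`convSet`) be the set of environments in which, for each test function, the expectation over the
walks that never go below level `0` converges to its `W`-integral times the probability of never
going below. This event depends only on the sites `x` with `0 ≤ x · u`. The test functions
asymptotically forget any initial piece of the path (`tendsto_testFun_increments`), so by the Markov
property limits can be computed on pieces cut at a fixed time. Splitting the complementary event by
the time of first exit from the half-space gives `G` almost surely under `Pinf` (`ConvOn.stay`).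
Conversely, under transience the walk has a first time of global minimum in direction `u`, after
which its increments stay in the half-space; splitting by that time recovers full convergence from
`G` at all shifts (`ConvOn.univ_of_stay`).

The transfer is `IsEquilibrium.ae_mem_of_ae_mem`. Suppose `P G < 1`. Under `P` the walk finds a
fresh environment on first reaching a level, so given the environment below that level it sees only
`G` with conditional probability at most `P G`. Letting the level grow, Lévy's upward theorem makes
this a quenched bound, and the Markov property improves it to `0`: almost surely the walk, from
every starting point, meets the complement of `G`. Under `Pinf` invariance keeps the environment
seen from the walk in `G` forever, and transience takes the walk above any level `ℓ` for good. Hence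
the event that some walk stays above `ℓ` and sees only `G` lies in `𝔖_ℓ`, has `Pinf`-probability `1`
and `P`-probability `0` for every `ℓ`, against the decay of the variation distance. -/

/-! ### Paths of the walk started at the origin -/

/-- The paths that agree with `y` up to time `n`. -/
def cyl {d : ℕ} (n : ℕ) (y : ℕ → Site d) : Set (ℕ → Site d) := {X | ∀ j ≤ n, X j = y j}

theorem measurableSet_cyl {d : ℕ} (n : ℕ) (y : ℕ → Site d) : MeasurableSet (cyl n y) := by
  have : cyl n y = ⋂ j ∈ Set.Iic n, (fun X : ℕ → Site d => X j) ⁻¹' {y j} := by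
    ext X; simp [cyl]
  rw [this]
  exact MeasurableSet.biInter (Set.to_countable _) fun j _ =>
    measurable_pi_apply j (MeasurableSet.singleton _)

/-- The family of all cylinders. -/
def cyls (d : ℕ) : Set (Set (ℕ → Site d)) := {C | ∃ n y, C = cyl n y}

theorem isPiSystem_cyls (d : ℕ) : IsPiSystem (cyls d) := by
  rintro _ ⟨n, y, rfl⟩ _ ⟨m, y', rfl⟩ ⟨X, hX, hX'⟩
  refine ⟨max n m, X, ?_⟩
  ext Y
  simp only [cyl, Set.mem_inter_iff, Set.mem_ofPred_eq] at *
  constructor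
  · rintro ⟨h, h'⟩ j hj
    rcases le_max_iff.1 hj with hj | hj
    · rw [h j hj, hX j hj]
    · rw [h' j hj, hX' j hj]
  · intro h
    exact ⟨fun j hj => (h j (hj.trans (le_max_left _ _))).trans (hX j hj),
      fun j hj => (h j (hj.trans (le_max_right _ _))).trans (hX' j hj)⟩

theorem generateFrom_cyls (d : ℕ) :
    (MeasurableSpace.pi : MeasurableSpace (ℕ → Site d)) = MeasurableSpace.generateFrom (cyls d) := by
  refine le_antisymm ?_ ?_
  · refine iSup_le fun j => ?_
    rw [← measurable_iff_comap_le]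
    refine @measurable_to_countable' _ _ _ _ (_) _ fun a => ?_
    have : (fun X : ℕ → Site d => X j) ⁻¹' {a} =
        ⋃ x ∈ {x : Fin (j + 1) → Site d | x (Fin.last j) = a},
          cyl j (fun i => if h : i < j + 1 then x ⟨i, h⟩ else 0) := by
      ext X
      simp only [Set.mem_preimage, Set.mem_singleton_iff, Set.mem_ofPred_eq, Set.mem_iUnion, cyl,
        exists_prop]
      constructor
      · rintro rfl
        refine ⟨fun i => X i, rfl, fun i hi => ?_⟩
        simp [Nat.lt_succ_iff.2 hi]
      · rintro ⟨x, rfl, h⟩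
        simpa [Fin.last] using h j le_rfl
    rw [this]
    exact MeasurableSet.biUnion (Set.to_countable _) fun x _ =>
      MeasurableSpace.measurableSet_generateFrom ⟨_, _, rfl⟩
  · refine MeasurableSpace.generateFrom_le ?_
    rintro _ ⟨n, y, rfl⟩
    exact measurableSet_cyl n y

/-- The law `P_0^ω` of the walk started at the origin. -/
noncomputable def pathLaw {d : ℕ} (ω : Env d) : Measure (ℕ → Site d) := (quenchedLaw ω 0 : Measure _)

instance {d : ℕ} (ω : Env d) : IsProbabilityMeasure (pathLaw ω) := by
  unfold pathLaw; infer_instance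

theorem stepKernel_singleton {d : ℕ} (ω : Env d) (x y : Site d) :
    stepKernel ω x {y} = ω x (y - x) := by
  change ((ω x).toMeasure.map (fun z => x + z)) {y} = _
  rw [Measure.map_apply (measurable_of_countable _) (MeasurableSet.singleton _)]
  have : (fun z => x + z) ⁻¹' {y} = {y - x} := by
    ext z
    rw [Set.mem_preimage, Set.mem_singleton_iff, Set.mem_singleton_iff, eq_sub_iff_add_eq']
  rw [this, PMF.toMeasure_apply_singleton _ _ (MeasurableSet.singleton _)]

theorem pathLaw_cyl_zero {d : ℕ} (ω : Env d) (y : ℕ → Site d) :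
    pathLaw ω (cyl 0 y) = if y 0 = 0 then 1 else 0 := by
  have h := Kernel.traj_map_frestrictLe_apply (X := fun _ => Site d) (κ := historyKernel ω) 0 0
    (fun _ => 0)
  rw [Kernel.partialTraj_self, Kernel.id_apply] at h
  have hc : cyl 0 y = Preorder.frestrictLe (π := fun _ => Site d) 0 ⁻¹'
      {x | x ⟨0, Finset.mem_Iic.2 le_rfl⟩ = y 0} := by
    ext X; simp [cyl]
  have hm : MeasurableSet {x : Finset.Iic 0 → Site d | x ⟨0, Finset.mem_Iic.2 le_rfl⟩ = y 0} :=
    (measurable_pi_apply (X := fun _ : Finset.Iic 0 => Site d)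
      (⟨0, Finset.mem_Iic.2 le_rfl⟩ : Finset.Iic 0)) (MeasurableSet.singleton (y 0))
  rw [hc, pathLaw, quenchedLaw]
  change (Kernel.traj (X := fun _ => Site d) (historyKernel ω) 0 (fun _ => 0)) _ = _
  rw [← Measure.map_apply (Preorder.measurable_frestrictLe 0) hm, h, Measure.dirac_apply' _ hm]
  simp [Set.indicator_apply, eq_comm]

theorem pathLaw_cyl_succ {d : ℕ} (ω : Env d) (n : ℕ) (y : ℕ → Site d) :
    pathLaw ω (cyl (n + 1) y) = pathLaw ω (cyl n y) * ω (y n) (y (n + 1) - y n) := by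
  have h := Kernel.partialTraj_compProd_eq_map_traj (X := fun _ => Site d) (κ := historyKernel ω)
    (Nat.zero_le n) (x₀ := fun _ => 0)
  rw [← Kernel.traj_map_frestrictLe_apply] at h
  set A : Set (Finset.Iic n → Site d) := {fun i : Finset.Iic n => y i}
  have hA : MeasurableSet A := MeasurableSet.singleton _
  have hc : cyl n y = Preorder.frestrictLe (π := fun _ => Site d) n ⁻¹' A := by
    ext X
    simp only [cyl, A, Set.mem_ofPred_eq, Set.mem_preimage, Set.mem_singleton_iff, funext_iff]
    exact ⟨fun h i => h i (Finset.mem_Iic.1 i.2), fun h j hj => h ⟨j, Finset.mem_Iic.2 hj⟩⟩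
  have hc' : cyl (n + 1) y = (fun X : ℕ → Site d =>
      (Preorder.frestrictLe (π := fun _ => Site d) n X, X (n + 1))) ⁻¹' (A ×ˢ {y (n + 1)}) := by
    rw [Set.mk_preimage_prod, ← hc]
    ext X
    simp only [cyl, Set.mem_ofPred_eq, Set.mem_inter_iff, Set.mem_preimage, Set.mem_singleton_iff]
    refine ⟨fun h => ⟨fun j hj => h j (by omega), h _ le_rfl⟩, fun h j hj => ?_⟩
    rcases Nat.lt_or_ge n j with hj' | hj'
    · obtain rfl : j = n + 1 := by omega
      exact h.2
    · exact h.1 j hj'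
  have hm : Measurable (fun X : ℕ → Site d =>
      (Preorder.frestrictLe (π := fun _ => Site d) n X, X (n + 1))) :=
    (Preorder.measurable_frestrictLe n).prodMk (measurable_pi_apply _)
  change (Kernel.traj (X := fun _ => Site d) (historyKernel ω) 0 (fun _ => 0)) _ =
    (Kernel.traj (X := fun _ => Site d) (historyKernel ω) 0 (fun _ => 0)) _ * _
  rw [hc', ← Measure.map_apply hm (hA.prod (MeasurableSet.singleton _)), ← h,
    Measure.compProd_apply_prod hA (MeasurableSet.singleton _), hc,
    ← Measure.map_apply (Preorder.measurable_frestrictLe n) hA,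
    show (∫⁻ a in A, historyKernel ω n a {y (n + 1)}
      ∂((Kernel.traj (X := fun _ => Site d) (historyKernel ω) 0 (fun _ => 0)).map
        (Preorder.frestrictLe n))) = ∫⁻ a in A, ω (y n) (y (n + 1) - y n)
      ∂((Kernel.traj (X := fun _ => Site d) (historyKernel ω) 0 (fun _ => 0)).map
        (Preorder.frestrictLe n)) from setLIntegral_congr_fun hA ?_]
  · rw [setLIntegral_const, mul_comm]
  · rintro a rfl
    exact stepKernel_singleton ω _ _

theorem cyl_anti {d : ℕ} {n m : ℕ} (h : n ≤ m) (y : ℕ → Site d) : cyl m y ⊆ cyl n y :=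
  fun _ hX j hj => hX j (hj.trans h)

theorem pathLaw_cyl_of_ne {d : ℕ} (ω : Env d) (n : ℕ) (y : ℕ → Site d) (h : y 0 ≠ 0) :
    pathLaw ω (cyl n y) = 0 :=
  measure_mono_null (cyl_anti (Nat.zero_le n) y) (by rw [pathLaw_cyl_zero, if_neg h])

/-- The trajectory measure is built by appending last steps; this turns the product formula around,
so that the first step is split off and the rest is a walk in the shifted environment. -/
theorem pathLaw_cyl_step {d : ℕ} (ω : Env d) (n : ℕ) (y : ℕ → Site d) (h : y 0 = 0) :
    pathLaw ω (cyl (n + 1) y) =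
      ω 0 (y 1) * pathLaw (shift (y 1) ω) (cyl n (fun j => y (j + 1) - y 1)) := by
  induction n with
  | zero => simp [pathLaw_cyl_succ, pathLaw_cyl_zero, h]
  | succ n ih =>
    rw [pathLaw_cyl_succ, ih, pathLaw_cyl_succ _ n, mul_assoc]
    simp [shift]

theorem ae_path_zero {d : ℕ} (ω : Env d) : ∀ᵐ X ∂pathLaw ω, X 0 = 0 := by
  have h := pathLaw_cyl_zero ω (fun _ => 0)
  rw [if_pos rfl, ← mem_ae_iff_prob_eq_one (measurableSet_cyl _ _)] at h
  filter_upwards [h] with X hX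
  simpa [cyl] using hX

/-! ### First-step decomposition and measurability in the environment -/

/-- The path that starts at the origin, steps to `z` and then follows `X`. -/
def stepPath {d : ℕ} (z : Site d) (X : ℕ → Site d) : ℕ → Site d
  | 0 => 0
  | n + 1 => z + X n

theorem measurable_stepPath {d : ℕ} (z : Site d) : Measurable (stepPath z) := by
  refine measurable_pi_lambda _ fun n => ?_
  cases n with
  | zero => exact measurable_const
  | succ n => exact (measurable_of_countable (fun x : Site d => z + x)).comp (measurable_pi_apply n)

/-- Both sides are probability measures that agree on the π-system of cylinders. The inductions on
time below all rest on this decomposition. -/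
theorem pathLaw_eq_sum {d : ℕ} (ω : Env d) :
    pathLaw ω = Measure.sum fun z => ω 0 z • (pathLaw (shift z ω)).map (stepPath z) := by
  have hmap : ∀ z, (pathLaw (shift z ω)).map (stepPath z) Set.univ = 1 := fun z => by
    rw [Measure.map_apply (measurable_stepPath z) MeasurableSet.univ, Set.preimage_univ,
      measure_univ]
  refine ext_of_generate_finite (cyls d) (generateFrom_cyls d) (isPiSystem_cyls d) ?_ ?_
  · rintro _ ⟨n, y, rfl⟩
    rw [Measure.sum_apply _ (measurableSet_cyl n y)]
    simp only [Measure.smul_apply, smul_eq_mul,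
      Measure.map_apply (measurable_stepPath _) (measurableSet_cyl n y)]
    by_cases h0 : y 0 = 0
    · cases n with
      | zero =>
        have : ∀ z, stepPath z ⁻¹' cyl 0 y = Set.univ := fun z => by
          ext X; simp [cyl, stepPath, h0]
        simp [pathLaw_cyl_zero, h0, this, (ω 0).tsum_coe]
      | succ n =>
        have : ∀ z, stepPath z ⁻¹' cyl (n + 1) y = cyl n (fun j => y (j + 1) - z) := fun z => by
          ext X
          simp only [cyl, Set.mem_preimage, Set.mem_ofPred_eq]
          refine ⟨fun h j hj => eq_sub_iff_add_eq'.2 (h (j + 1) (by omega)), fun h j hj => ?_⟩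
          cases j with
          | zero => exact h0.symm
          | succ j => exact eq_sub_iff_add_eq'.1 (h j (by omega))
        simp only [this]
        rw [tsum_eq_single (y 1), pathLaw_cyl_step ω n y h0]
        intro z hz
        rw [pathLaw_cyl_of_ne _ _ _ (sub_ne_zero.2 (Ne.symm hz)), mul_zero]
    · have : ∀ z, stepPath z ⁻¹' cyl n y = ∅ := fun z => by
        ext X
        simp only [cyl, Set.mem_preimage, Set.mem_ofPred_eq, Set.mem_empty_iff_false, iff_false]
        exact fun h => h0 (h 0 (Nat.zero_le n)).symm
      simp [this, pathLaw_cyl_of_ne _ _ _ h0]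
  · rw [Measure.sum_apply _ MeasurableSet.univ]
    simp [hmap, (ω 0).tsum_coe]

theorem lintegral_pathLaw {d : ℕ} (ω : Env d) {Φ : (ℕ → Site d) → ℝ≥0∞} (hΦ : Measurable Φ) :
    ∫⁻ X, Φ X ∂pathLaw ω = ∑' z, ω 0 z * ∫⁻ X, Φ (stepPath z X) ∂pathLaw (shift z ω) := by
  conv_lhs => rw [pathLaw_eq_sum]
  rw [lintegral_sum_measure]
  simp only [lintegral_smul_measure, smul_eq_mul, lintegral_map hΦ (measurable_stepPath _)]

/-- The laws of the walk started at the origin, as a kernel from environments to paths. -/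
noncomputable def pathKernel (d : ℕ) : Kernel (Env d) (ℕ → Site d) where
  toFun := pathLaw
  measurable' := by
    refine Measurable.measure_of_isPiSystem_of_isProbabilityMeasure (generateFrom_cyls d)
      (isPiSystem_cyls d) ?_
    rintro _ ⟨n, y, rfl⟩
    induction n with
    | zero => simp only [pathLaw_cyl_zero]; exact measurable_const
    | succ n ih =>
      simp only [pathLaw_cyl_succ]
      exact ih.mul ((measurable_prob _).comp (measurable_pi_apply _))

theorem pathKernel_apply {d : ℕ} (ω : Env d) : pathKernel d ω = pathLaw ω := rfl

instance (d : ℕ) : IsMarkovKernel (pathKernel d) := ⟨fun ω => by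
  rw [pathKernel_apply]; infer_instance⟩

/-! ### The Markov property -/

/-- The path that follows `X` up to time `k` and then the increments of `Y`. -/
def splice {d : ℕ} (k : ℕ) (X Y : ℕ → Site d) (j : ℕ) : Site d :=
  if j ≤ k then X j else X k + Y (j - k)

theorem splice_stepPath {d : ℕ} (k : ℕ) (z : Site d) (X Y : ℕ → Site d) :
    splice (k + 1) (stepPath z X) Y = stepPath z (splice k X Y) := by
  funext j
  cases j with
  | zero => simp [splice, stepPath]
  | succ j =>
    by_cases h : j ≤ k
    · simp [splice, stepPath, h]
    · simp [splice, stepPath, h, add_assoc]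

theorem measurable_splice {d : ℕ} (k : ℕ) :
    Measurable fun p : (ℕ → Site d) × (ℕ → Site d) => splice k p.1 p.2 := by
  refine measurable_pi_lambda _ fun j => ?_
  unfold splice
  split_ifs with h
  · exact (measurable_pi_apply j).comp measurable_fst
  · have : Measurable fun q : Site d × Site d => q.1 + q.2 := measurable_of_countable _
    have h' : Measurable fun p : (ℕ → Site d) × (ℕ → Site d) => (p.1 k, p.2 (j - k)) :=
      ((measurable_pi_apply k).comp measurable_fst).prodMk
        ((measurable_pi_apply (j - k)).comp measurable_snd)
    exact this.comp h'

theorem shift_shift {d : ℕ} (x y : Site d) (ω : Env d) :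
    shift x (shift y ω) = shift (y + x) ω := by
  funext a; simp only [shift]; congr 1; abel

theorem shift_zero {d : ℕ} (ω : Env d) : shift 0 ω = ω := by
  funext a; simp [shift]

theorem measurable_lintegral_shift {d : ℕ} (k : ℕ) (ω : Env d)
    {Φ : (ℕ → Site d) → (ℕ → Site d) → ℝ≥0∞} (hΦ : Measurable (Function.uncurry Φ)) :
    Measurable fun X : ℕ → Site d => ∫⁻ Y, Φ X Y ∂pathLaw (shift (X k) ω) := by
  let κ : Kernel (ℕ → Site d) (ℕ → Site d) :=
    (pathKernel d).comap (fun X => shift (X k) ω)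
      ((measurable_of_countable (fun z : Site d => shift z ω)).comp (measurable_pi_apply k))
  exact hΦ.lintegral_kernel_prod_right' (κ := κ)

/-- The Markov property at time `k`. -/
theorem lintegral_markov {d : ℕ} (k : ℕ) (ω : Env d) {Φ : (ℕ → Site d) → ℝ≥0∞}
    (hΦ : Measurable Φ) :
    ∫⁻ X, Φ X ∂pathLaw ω =
      ∫⁻ X, ∫⁻ Y, Φ (splice k X Y) ∂pathLaw (shift (X k) ω) ∂pathLaw ω := by
  induction k generalizing ω Φ with
  | zero =>
    have h1 : ∀ᵐ X ∂pathLaw ω, ∫⁻ Y, Φ (splice 0 X Y) ∂pathLaw (shift (X 0) ω)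
        = ∫⁻ Y, Φ Y ∂pathLaw ω := by
      filter_upwards [ae_path_zero ω] with X hX
      rw [hX, shift_zero]
      refine lintegral_congr_ae ?_
      filter_upwards [ae_path_zero ω] with Y hY
      congr 1
      funext j
      cases j with
      | zero => simp [splice, hX, hY]
      | succ j => simp [splice, hX]
    rw [lintegral_congr_ae h1]
    simp
  | succ k ih =>
    have hm := (measurable_lintegral_shift (k + 1) ω (Φ := fun X Y => Φ (splice (k + 1) X Y))
      (hΦ.comp (measurable_splice (k + 1))))
    rw [lintegral_pathLaw ω hΦ, lintegral_pathLaw ω hm]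
    refine tsum_congr fun z => ?_
    -- After a first step to `z`, time `k + 1` is time `k` for the walk in `shift z ω`, and splicing
    -- commutes with prepending the step.
    rw [ih (shift z ω) (Φ := fun X => Φ (stepPath z X)) (hΦ.comp (measurable_stepPath z))]
    simp only [splice_stepPath, shift_shift, stepPath]

/-! ### Dependence of the path law on the environment -/

/-- Up to time `n` the walk consults the environment only at the sites it leaves, `X 0, …, X (n -
1)`; hence the strict `j < n` in `hsupp`. The endpoint `X n` may lie outside `H`, which matters for
first entries. -/
theorem lintegral_pathLaw_congr {d : ℕ} (n : ℕ) (H : Set (Site d)) {ω ω' : Env d}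
    (hω : ∀ x ∈ H, ω x = ω' x) {Φ : (ℕ → Site d) → ℝ≥0∞} (hΦ : Measurable Φ)
    (hdep : ∀ X Y : ℕ → Site d, (∀ j ≤ n, X j = Y j) → Φ X = Φ Y)
    (hsupp : ∀ X, Φ X ≠ 0 → ∀ j < n, X j ∈ H) :
    ∫⁻ X, Φ X ∂pathLaw ω = ∫⁻ X, Φ X ∂pathLaw ω' := by
  induction n generalizing H ω ω' Φ with
  | zero =>
    have : ∀ ω : Env d, ∫⁻ X, Φ X ∂pathLaw ω = Φ 0 := fun ω => by
      have h : ∀ᵐ X ∂pathLaw ω, Φ X = Φ 0 := by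
        filter_upwards [ae_path_zero ω] with X hX
        refine hdep _ _ fun j hj => ?_
        obtain rfl : j = 0 := by omega
        simpa using hX
      rw [lintegral_congr_ae h]
      simp
    rw [this, this]
  | succ n ih =>
    by_cases h0 : (0 : Site d) ∈ H
    · rw [lintegral_pathLaw ω hΦ, lintegral_pathLaw ω' hΦ, hω 0 h0]
      refine tsum_congr fun z => ?_
      refine congrArg (ω' 0 z * ·) (ih {x | z + x ∈ H} (Φ := fun X => Φ (stepPath z X))
        (fun x hx => ?_) (hΦ.comp (measurable_stepPath z))
        (fun X Y hXY => hdep _ _ fun j hj => ?_) (fun X hX j hj => ?_))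
      · have := hω (z + x) hx
        simpa [shift, add_comm] using this
      · cases j with
        | zero => rfl
        | succ j => simp [stepPath, hXY j (by omega)]
      · have := hsupp (stepPath z X) hX (j + 1) (by omega)
        exact this
    · have : ∀ ω : Env d, ∫⁻ X, Φ X ∂pathLaw ω = 0 := fun ω => by
        have h : ∀ᵐ X ∂pathLaw ω, Φ X = 0 := by
          filter_upwards [ae_path_zero ω] with X hX
          by_contra hne
          exact h0 (hX ▸ hsupp X hne 0 (by omega))
        rw [lintegral_congr_ae h]
        simp
      rw [this, this]

theorem pathLaw_congr {d : ℕ} (n : ℕ) (H : Set (Site d)) {ω ω' : Env d}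
    (hω : ∀ x ∈ H, ω x = ω' x) {A : Set (ℕ → Site d)} (hA : MeasurableSet A)
    (hdep : ∀ X Y : ℕ → Site d, (∀ j ≤ n, X j = Y j) → X ∈ A → Y ∈ A)
    (hsupp : ∀ X ∈ A, ∀ j < n, X j ∈ H) : pathLaw ω A = pathLaw ω' A := by
  rw [← lintegral_indicator_one hA, ← lintegral_indicator_one hA]
  refine lintegral_pathLaw_congr n H hω (measurable_const.indicator hA) (fun X Y hXY => ?_)
    (fun X hX => hsupp X (Set.mem_of_indicator_ne_zero hX))
  have : X ∈ A ↔ Y ∈ A := ⟨hdep X Y hXY, hdep Y X fun j hj => (hXY j hj).symm⟩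
  by_cases h : X ∈ A
  · simp [h, this.1 h]
  · simp [h, mt this.2 h]

/-- The paths that never leave `H`. -/
def stay {d : ℕ} (H : Set (Site d)) : Set (ℕ → Site d) := {X | ∀ n, X n ∈ H}

theorem measurableSet_stay {d : ℕ} (H : Set (Site d)) : MeasurableSet (stay H) := by
  have : stay H = ⋂ n, (fun X : ℕ → Site d => X n) ⁻¹' H := by ext X; simp [stay]
  rw [this]
  exact MeasurableSet.iInter fun n => measurable_pi_apply n (Set.to_countable H).measurableSet

/-- Never leaving `H` is not a finite-time event; it is the decreasing limit of staying in `H`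
before time `n + m`, to which `pathLaw_congr` applies. -/
theorem pathLaw_inter_stay_congr {d : ℕ} (H : Set (Site d)) {ω ω' : Env d}
    (hω : ∀ x ∈ H, ω x = ω' x) (n : ℕ) {A : Set (ℕ → Site d)} (hA : MeasurableSet A)
    (hdep : ∀ X Y : ℕ → Site d, (∀ j ≤ n, X j = Y j) → X ∈ A → Y ∈ A) :
    pathLaw ω (A ∩ stay H) = pathLaw ω' (A ∩ stay H) := by
  let S : ℕ → Set (ℕ → Site d) := fun m => A ∩ ⋂ j ∈ Set.Iio (n + m), (fun X => X j) ⁻¹' H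
  have hS : ∀ m, MeasurableSet (S m) := fun m => hA.inter <|
    MeasurableSet.biInter (Set.to_countable _) fun j _ =>
      measurable_pi_apply j (Set.to_countable H).measurableSet
  have hanti : Antitone S := fun m m' h => Set.inter_subset_inter_right _ <|
    Set.biInter_mono (fun j (hj : j < n + m) => (by omega : j < n + m')) fun _ _ => le_rfl
  have hI : A ∩ stay H = ⋂ m, S m := by
    ext X
    simp only [S, stay, Set.mem_inter_iff, Set.mem_iInter, Set.mem_ofPred_eq, Set.mem_preimage,
      Set.mem_Iio]
    exact ⟨fun h m => ⟨h.1, fun j _ => h.2 j⟩,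
      fun h => ⟨(h 0).1, fun j => (h (j + 1)).2 j (by omega)⟩⟩
  have hlim : ∀ ω : Env d, Tendsto (fun m => pathLaw ω (S m)) atTop
      (𝓝 (pathLaw ω (A ∩ stay H))) := fun ω => by
    rw [hI]
    exact tendsto_measure_iInter_atTop (fun m => (hS m).nullMeasurableSet) hanti
      ⟨0, measure_ne_top _ _⟩
  refine tendsto_nhds_unique (hlim ω) ((hlim ω').congr fun m => ?_)
  refine (pathLaw_congr (n + m) H hω (hS m) (fun X Y hXY hX => ?_) fun X hX j hj => ?_).symm
  · simp only [S, Set.mem_inter_iff, Set.mem_iInter, Set.mem_preimage, Set.mem_Iio] at hX ⊢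
    exact ⟨hdep X Y (fun j hj => hXY j (by omega)) hX.1,
      fun j hj => hXY j (by omega) ▸ hX.2 j hj⟩
  · simp only [S, Set.mem_inter_iff, Set.mem_iInter, Set.mem_preimage, Set.mem_Iio] at hX
    exact hX.2 j hj

theorem restrict_stay_congr {d : ℕ} (H : Set (Site d)) {ω ω' : Env d}
    (hω : ∀ x ∈ H, ω x = ω' x) :
    (pathLaw ω).restrict (stay H) = (pathLaw ω').restrict (stay H) := by
  refine ext_of_generate_finite (cyls d) (generateFrom_cyls d) (isPiSystem_cyls d) ?_ ?_
  · rintro _ ⟨n, y, rfl⟩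
    rw [Measure.restrict_apply (measurableSet_cyl n y), Measure.restrict_apply (measurableSet_cyl n y)]
    exact pathLaw_inter_stay_congr H hω n (measurableSet_cyl n y)
      fun X Y hXY hX j hj => (hXY j hj).symm.trans (hX j hj)
  · rw [Measure.restrict_apply MeasurableSet.univ, Measure.restrict_apply MeasurableSet.univ]
    exact pathLaw_inter_stay_congr H hω 0 MeasurableSet.univ fun _ _ _ _ => Set.mem_univ _

/-! ### Properties that persist along the walk -/

/-- Almost sure properties of the environment persist when the walk makes a step. -/
def StepStable {d : ℕ} (μ : Measure (Env d)) : Prop :=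
  ∀ q : Env d → Prop, (∀ᵐ ω ∂μ, q ω) → ∀ᵐ ω ∂μ, ∀ z, ω 0 z ≠ 0 → q (shift z ω)

/-- The set `Γ` of environments is closed under the steps of the walk. -/
def StepClosed {d : ℕ} (Γ : Set (Env d)) : Prop := ∀ ω ∈ Γ, ∀ z, ω 0 z ≠ 0 → shift z ω ∈ Γ

/-- Let `Q k` say that `q` holds after any `k` possible steps. Each `Q k` is almost sure, and the
set where all of them hold is closed under one more step. -/
theorem StepStable.exists_stepClosed {d : ℕ} {μ : Measure (Env d)} (hμ : StepStable μ)
    {q : Env d → Prop} (hq : ∀ᵐ ω ∂μ, q ω) :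
    ∃ Γ : Set (Env d), (∀ᵐ ω ∂μ, ω ∈ Γ) ∧ (∀ ω ∈ Γ, q ω) ∧ StepClosed Γ := by
  let Q : ℕ → Env d → Prop := fun k =>
    Nat.rec q (fun _ r ω => ∀ z, ω 0 z ≠ 0 → r (shift z ω)) k
  have hQ : ∀ k, ∀ᵐ ω ∂μ, Q k ω := fun k => by
    induction k with
    | zero => exact hq
    | succ k ih => exact hμ _ ih
  exact ⟨{ω | ∀ k, Q k ω}, ae_all_iff.2 hQ, fun ω hω => hω 0, fun ω hω z hz k => hω (k + 1) z hz⟩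

theorem ae_step_ne_zero {d : ℕ} (ω : Env d) :
    ∀ᵐ X ∂pathLaw ω, ∀ k, ω (X k) (X (k + 1) - X k) ≠ 0 := by
  refine ae_all_iff.2 fun k => ?_
  rw [ae_iff]
  -- The bad paths are covered by the countably many cylinders whose last step is forbidden.
  refine measure_mono_null (t := ⋃ x ∈ {x : Fin (k + 2) → Site d |
    ω (x (Fin.last k).castSucc) (x (Fin.last (k + 1)) - x (Fin.last k).castSucc) = 0},
    cyl (k + 1) (fun i => if h : i < k + 2 then x ⟨i, h⟩ else 0)) (fun X hX => ?_) ?_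
  · simp only [not_not] at hX
    refine Set.mem_iUnion₂.2 ⟨fun i => X i, by simpa using hX, fun j hj => ?_⟩
    simp [Nat.lt_succ_iff.2 hj]
  · refine (measure_biUnion_null_iff (Set.to_countable _)).2 fun x hx => ?_
    rw [pathLaw_cyl_succ]
    have h1 : k < k + 2 := by omega
    have h2 : k + 1 < k + 2 := by omega
    simp only [h1, h2, dif_pos]
    exact mul_eq_zero_of_right _ hx

theorem StepClosed.ae_path {d : ℕ} {Γ : Set (Env d)} (hΓ : StepClosed Γ) {ω : Env d} (hω : ω ∈ Γ) :
    ∀ᵐ X ∂pathLaw ω, ∀ k, shift (X k) ω ∈ Γ := by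
  filter_upwards [ae_path_zero ω, ae_step_ne_zero ω] with X h0 hX k
  induction k with
  | zero => rwa [h0, shift_zero]
  | succ k ih =>
    have := hΓ _ ih (X (k + 1) - X k) (by simpa [shift] using hX k)
    rwa [shift_shift, add_sub_cancel] at this

theorem map_shift_infinitePi {d : ℕ} (μ : Measure (StepLaw d)) [IsProbabilityMeasure μ]
    (z : Site d) : (Measure.infinitePi (fun _ : Site d => μ)).map (shift z) =
      Measure.infinitePi (fun _ : Site d => μ) := by
  classical
  refine Measure.eq_infinitePi _ fun s t ht => ?_
  have hinj : Function.Injective fun x : Site d => x + z := add_left_injective z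
  have hpre : shift z ⁻¹' (Set.pi (s : Set (Site d)) t) =
      Set.pi ((s.image fun x => x + z : Finset (Site d)) : Set (Site d)) fun x => t (x - z) := by
    ext ω
    simp only [shift, Set.mem_pi, Set.mem_preimage, Finset.mem_coe, Finset.mem_image]
    refine ⟨?_, fun h i hi => by simpa using h (i + z) ⟨i, hi, rfl⟩⟩
    rintro h _ ⟨i, hi, rfl⟩
    simpa using h i hi
  rw [Measure.map_apply (measurable_shift z)
    (MeasurableSet.pi s.countable_toSet fun i _ => ht i), hpre,
    Measure.infinitePi_pi _ fun i _ => ht _, Finset.prod_image fun x _ y _ h => hinj h]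
  simp

theorem IsIIDProduct.isProbabilityMeasure {d : ℕ} {P : Measure (Env d)} (hP : IsIIDProduct P) :
    IsProbabilityMeasure P := by
  obtain ⟨μ, hμ, rfl⟩ := hP
  infer_instance

theorem IsIIDProduct.map_shift {d : ℕ} {P : Measure (Env d)} (hP : IsIIDProduct P) (z : Site d) :
    P.map (shift z) = P := by
  obtain ⟨μ, hμ, rfl⟩ := hP
  exact map_shift_infinitePi μ z

theorem IsIIDProduct.ae_shift {d : ℕ} {P : Measure (Env d)} (hP : IsIIDProduct P)
    {q : Env d → Prop} (hq : ∀ᵐ ω ∂P, q ω) : ∀ᵐ ω ∂P, ∀ z, q (shift z ω) := by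
  refine ae_all_iff.2 fun z => ?_
  rw [← hP.map_shift z] at hq
  exact ae_of_ae_map (measurable_shift z).aemeasurable hq

theorem IsIIDProduct.stepStable {d : ℕ} {P : Measure (Env d)} (hP : IsIIDProduct P) :
    StepStable P := fun _ hq => (hP.ae_shift hq).mono fun _ h z _ => h z

/-- Invariance gives `∫ Π(ω, N) dPinf = Pinf N = 0` for a null set `N`, so for almost every `ω` no
possible step leads into `N`. -/
theorem IsEquilibrium.stepStable {d : ℕ} {u : Site d} {P Pinf : Measure (Env d)}
    (h : IsEquilibrium u P Pinf) : StepStable Pinf := by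
  intro q hq
  -- The property `q` need not be measurable, so its exceptional set is enlarged to a measurable
  -- null set.
  obtain ⟨N, hN, hNm, hN0⟩ := exists_measurable_superset_of_null (ae_iff.1 hq)
  have h1 : Pinf.bind (envKernel d) N = 0 := by rw [h.invariant.def, hN0]
  rw [Measure.bind_apply hNm (envKernel d).aemeasurable,
    lintegral_eq_zero_iff ((envKernel d).measurable_coe hNm)] at h1
  filter_upwards [h1] with ω hω z hz
  by_contra hq
  change ((ω 0).toMeasure.map (fun z => shift z ω)) N = 0 at hω
  have hm : Measurable (fun z => shift z ω) := measurable_of_countable _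
  rw [Measure.map_apply hm hNm, PMF.toMeasure_apply_eq_zero_iff _ (hm hNm)] at hω
  exact Set.disjoint_left.1 hω ((PMF.mem_support_iff _ _).2 hz) (hN hq)

/-! ### Transience -/

theorem exp_le_one_add_add_sq_mul_exp_abs (x : ℝ) :
    Real.exp x ≤ 1 + x + x ^ 2 * Real.exp |x| := by
  have h1 : 1 ≤ Real.exp |x| := Real.one_le_exp (abs_nonneg x)
  have hs : x ^ 2 ≤ x ^ 2 * Real.exp |x| := le_mul_of_one_le_right (sq_nonneg x) h1
  rcases le_or_gt |x| 1 with h | h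
  · have := (abs_le.1 (Real.abs_exp_sub_one_sub_id_le h)).2
    linarith
  · rcases lt_abs.1 h with h | h
    · rw [abs_of_pos (by linarith)]
      have : Real.exp x ≤ x ^ 2 * Real.exp x :=
        le_mul_of_one_le_left (Real.exp_pos x).le (by nlinarith)
      linarith
    · have : Real.exp x ≤ 1 := Real.exp_le_one_iff.2 (by linarith)
      nlinarith

theorem abs_dotProduct_le {d : ℕ} (z u : Site d) :
    |((z ⬝ᵥ u : ℤ) : ℝ)| ≤ (∑ i, |(u i : ℝ)|) * ‖toSpace z‖ := by
  rw [dotProduct, Finset.sum_mul]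
  push_cast
  refine (Finset.abs_sum_le_sum_abs _ _).trans (Finset.sum_le_sum fun i _ => ?_)
  rw [abs_mul, mul_comm]
  refine mul_le_mul_of_nonneg_left ?_ (abs_nonneg _)
  have := PiLp.norm_apply_le (toSpace z) i
  simpa [toSpace] using this

theorem exp_neg_mul_dotProduct_le {d : ℕ} (u : Site d) {s₀ : ℝ} (hs₀ : 0 < s₀) :
    ∃ K s₁ : ℝ, 0 < K ∧ 0 < s₁ ∧ ∀ s, 0 < s → s ≤ s₁ → ∀ z : Site d,
      Real.exp (-s * ((z ⬝ᵥ u : ℤ) : ℝ)) ≤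
        1 - s * ((z ⬝ᵥ u : ℤ) : ℝ) + s ^ 2 * K * Real.exp (s₀ * ‖toSpace z‖) := by
  set U : ℝ := ∑ i, |(u i : ℝ)| with hU
  have hU0 : 0 ≤ U := Finset.sum_nonneg fun i _ => abs_nonneg _
  -- The range of `s` makes `s * U ≤ s₀ / 2`. Half of the exponent `s₀ * r` then pays for `exp |s *
  -- y|`, and the other half for `y ^ 2`, through `x ^ 2 / 2 ≤ exp x` at `x = s₀ * r / 2`. The added
  -- ones keep the constants well defined and positive when `U = 0`.
  refine ⟨8 * U ^ 2 / s₀ ^ 2 + 1, s₀ / (2 * (U + 1)), by positivity, by positivity,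
    fun s hs hs1 z => ?_⟩
  set y : ℝ := ((z ⬝ᵥ u : ℤ) : ℝ)
  set r : ℝ := ‖toSpace z‖
  have hr : 0 ≤ r := norm_nonneg _
  have hy : |y| ≤ U * r := abs_dotProduct_le z u
  have h1 := exp_le_one_add_add_sq_mul_exp_abs (-s * y)
  have hsU : s * U ≤ s₀ / 2 := by
    rw [le_div_iff₀ (by positivity)] at hs1
    nlinarith
  have h2 : |-s * y| ≤ s₀ / 2 * r := by
    rw [abs_mul, abs_neg, abs_of_pos hs]
    calc s * |y| ≤ s * (U * r) := mul_le_mul_of_nonneg_left hy hs.le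
      _ = s * U * r := by ring
      _ ≤ _ := mul_le_mul_of_nonneg_right hsU hr
  have h3 : y ^ 2 ≤ U ^ 2 * r ^ 2 := by
    rw [← sq_abs, ← mul_pow]
    exact pow_le_pow_left₀ (abs_nonneg _) hy 2
  have h4 : r ^ 2 ≤ 8 / s₀ ^ 2 * Real.exp (s₀ / 2 * r) := by
    have := Real.quadratic_le_exp_of_nonneg (x := s₀ / 2 * r) (by positivity)
    rw [div_mul_eq_mul_div, le_div_iff₀ (by positivity)]
    nlinarith [mul_nonneg hs₀.le hr]
  have h5 : y ^ 2 ≤ (8 * U ^ 2 / s₀ ^ 2 + 1) * Real.exp (s₀ / 2 * r) := by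
    calc y ^ 2 ≤ U ^ 2 * r ^ 2 := h3
      _ ≤ U ^ 2 * (8 / s₀ ^ 2 * Real.exp (s₀ / 2 * r)) :=
        mul_le_mul_of_nonneg_left h4 (sq_nonneg U)
      _ = 8 * U ^ 2 / s₀ ^ 2 * Real.exp (s₀ / 2 * r) := by ring
      _ ≤ _ := mul_le_mul_of_nonneg_right (by linarith) (Real.exp_pos _).le
  have h6 : (-s * y) ^ 2 * Real.exp |-s * y| ≤
      s ^ 2 * (8 * U ^ 2 / s₀ ^ 2 + 1) * Real.exp (s₀ * r) := by
    calc (-s * y) ^ 2 * Real.exp |-s * y| ≤ (-s * y) ^ 2 * Real.exp (s₀ / 2 * r) :=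
          mul_le_mul_of_nonneg_left (Real.exp_le_exp.2 h2) (sq_nonneg _)
      _ = s ^ 2 * y ^ 2 * Real.exp (s₀ / 2 * r) := by ring
      _ ≤ s ^ 2 * ((8 * U ^ 2 / s₀ ^ 2 + 1) * Real.exp (s₀ / 2 * r)) * Real.exp (s₀ / 2 * r) := by
        gcongr
      _ = s ^ 2 * (8 * U ^ 2 / s₀ ^ 2 + 1) * (Real.exp (s₀ / 2 * r) * Real.exp (s₀ / 2 * r)) := by
        ring
      _ = _ := by rw [← Real.exp_add]; congr 2; ring
  linarith

/-- A step law with a drift and exponential moments contracts some exponential function. -/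
theorem exists_contraction {d : ℕ} (u : Site d) {δ M s₀ : ℝ} (hδ : 0 < δ) (hs₀ : 0 < s₀) :
    ∃ s : ℝ, 0 < s ∧ ∃ ρ : ℝ≥0∞, ρ < 1 ∧ ∀ p : StepLaw d,
      δ ≤ ∑' z : Site d, ((z ⬝ᵥ u : ℤ) : ℝ) * (p z).toReal →
      ∑' z : Site d, ENNReal.ofReal (Real.exp (s₀ * ‖toSpace z‖)) * p z
        ≤ ENNReal.ofReal (Real.exp (s₀ * M)) →
      ∑' z : Site d, p z * ENNReal.ofReal (Real.exp (-s * ((z ⬝ᵥ u : ℤ) : ℝ))) ≤ ρ := by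
  obtain ⟨K, s₁, hK, hs₁, hexp⟩ := exp_neg_mul_dotProduct_le u hs₀
  set E : ℝ := Real.exp (s₀ * M)
  have hE : 0 < E := Real.exp_pos _
  -- Integrating the pointwise bound gives `1 - s * δ + s ^ 2 * K * E`; this `s` makes the quadratic
  -- term at most half of the drift term.
  set s : ℝ := min s₁ (δ / (2 * K * E)) with hs
  have hs0 : 0 < s := lt_min hs₁ (by positivity)
  have hsK : s * K * E ≤ δ / 2 := by
    have : s ≤ δ / (2 * K * E) := min_le_right _ _
    rw [le_div_iff₀ (by positivity)] at this
    linarith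
  refine ⟨s, hs0, ENNReal.ofReal (1 - s * δ / 2), ?_, fun p hp hM => ?_⟩
  · rw [← ENNReal.ofReal_one]
    exact (ENNReal.ofReal_lt_ofReal_iff one_pos).2 (by nlinarith)
  have hpt : ∀ z, p z ≠ ∞ := fun z => p.apply_ne_top z
  have hp1 : HasSum (fun z => (p z).toReal) 1 := by
    have := ENNReal.hasSum_toReal (f := fun z => p z) (by rw [p.tsum_coe]; exact ENNReal.one_ne_top)
    rwa [← ENNReal.tsum_toReal_eq hpt, p.tsum_coe, ENNReal.toReal_one] at this
  -- A divergent series has `tsum` equal to `0`, which `hp` rules out because `δ > 0`.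
  have hp2 : Summable fun z : Site d => ((z ⬝ᵥ u : ℤ) : ℝ) * (p z).toReal := by
    by_contra h
    rw [tsum_eq_zero_of_not_summable h] at hp
    linarith
  have hfin : ∑' z : Site d, ENNReal.ofReal (Real.exp (s₀ * ‖toSpace z‖)) * p z ≠ ∞ :=
    ne_top_of_le_ne_top ENNReal.ofReal_ne_top hM
  have hp3 := ENNReal.hasSum_toReal hfin
  have hfin' : ∀ z : Site d, ENNReal.ofReal (Real.exp (s₀ * ‖toSpace z‖)) * p z ≠ ∞ :=
    ENNReal.ne_top_of_tsum_ne_top hfin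
  rw [← ENNReal.tsum_toReal_eq hfin'] at hp3
  have hp3' : (∑' z : Site d, ENNReal.ofReal (Real.exp (s₀ * ‖toSpace z‖)) * p z).toReal ≤ E := by
    have := ENNReal.toReal_mono ENNReal.ofReal_ne_top hM
    rwa [ENNReal.toReal_ofReal hE.le] at this
  have hsum := (hp1.sub (hp2.hasSum.mul_left s)).add (hp3.mul_left (s ^ 2 * K))
  have hle : ∀ z : Site d, p z * ENNReal.ofReal (Real.exp (-s * ((z ⬝ᵥ u : ℤ) : ℝ))) ≤
      ENNReal.ofReal ((p z).toReal - s * (((z ⬝ᵥ u : ℤ) : ℝ) * (p z).toReal) + s ^ 2 * K *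
        (ENNReal.ofReal (Real.exp (s₀ * ‖toSpace z‖)) * p z).toReal) := fun z => by
    conv_lhs => rw [← ENNReal.ofReal_toReal (hpt z)]
    rw [← ENNReal.ofReal_mul ENNReal.toReal_nonneg, ENNReal.toReal_mul,
      ENNReal.toReal_ofReal (Real.exp_pos _).le]
    refine ENNReal.ofReal_le_ofReal ?_
    have := mul_le_mul_of_nonneg_left (hexp s hs0 (min_le_left _ _) z)
      (ENNReal.toReal_nonneg (a := p z))
    linarith
  have hnn : ∀ z : Site d, 0 ≤ (p z).toReal - s * (((z ⬝ᵥ u : ℤ) : ℝ) * (p z).toReal) +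
      s ^ 2 * K * (ENNReal.ofReal (Real.exp (s₀ * ‖toSpace z‖)) * p z).toReal := fun z => by
    rw [ENNReal.toReal_mul, ENNReal.toReal_ofReal (Real.exp_pos _).le]
    have := mul_le_mul_of_nonneg_left ((Real.exp_pos _).le.trans
      (hexp s hs0 (min_le_left _ _) z)) (ENNReal.toReal_nonneg (a := p z))
    linarith
  refine (ENNReal.tsum_le_tsum hle).trans ?_
  rw [← ENNReal.ofReal_tsum_of_nonneg hnn hsum.summable, hsum.tsum_eq]
  refine ENNReal.ofReal_le_ofReal ?_
  have h1 := mul_le_mul_of_nonneg_left hp hs0.le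
  have h2 := mul_le_mul_of_nonneg_left hp3' (by positivity : 0 ≤ s ^ 2 * K)
  have h3 := mul_le_mul_of_nonneg_left hsK hs0.le
  nlinarith

/-- One step contracts the exponential by `ρ`, and step-closedness of `Γ` makes the same bound
available in every environment that the walk can see. -/
theorem lintegral_exp_path_le {d : ℕ} (u : Site d) (s : ℝ) (ρ : ℝ≥0∞) {Γ : Set (Env d)}
    (hΓ : StepClosed Γ)
    (hρ : ∀ ω ∈ Γ, ∑' z, ω 0 z * ENNReal.ofReal (Real.exp (-s * ((z ⬝ᵥ u : ℤ) : ℝ))) ≤ ρ)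
    (n : ℕ) {ω : Env d} (hω : ω ∈ Γ) :
    ∫⁻ X, ENNReal.ofReal (Real.exp (-s * ((X n ⬝ᵥ u : ℤ) : ℝ))) ∂pathLaw ω ≤ ρ ^ n := by
  have hm : ∀ n, Measurable fun X : ℕ → Site d =>
      ENNReal.ofReal (Real.exp (-s * ((X n ⬝ᵥ u : ℤ) : ℝ))) := fun n =>
    (measurable_of_countable fun x : Site d =>
      ENNReal.ofReal (Real.exp (-s * ((x ⬝ᵥ u : ℤ) : ℝ)))).comp (measurable_pi_apply n)
  induction n generalizing ω with
  | zero =>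
    have : ∀ᵐ X ∂pathLaw ω, ENNReal.ofReal (Real.exp (-s * ((X 0 ⬝ᵥ u : ℤ) : ℝ))) = 1 := by
      filter_upwards [ae_path_zero ω] with X hX
      simp [hX]
    rw [lintegral_congr_ae this]
    simp
  | succ n ih =>
    rw [lintegral_pathLaw ω (hm (n + 1))]
    have hstep : ∀ z, ω 0 z * ∫⁻ X, ENNReal.ofReal
        (Real.exp (-s * ((stepPath z X (n + 1) ⬝ᵥ u : ℤ) : ℝ))) ∂pathLaw (shift z ω) ≤
        ω 0 z * ENNReal.ofReal (Real.exp (-s * ((z ⬝ᵥ u : ℤ) : ℝ))) * ρ ^ n := fun z => by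
      by_cases hz : ω 0 z = 0
      · simp [hz]
      have : ∀ X : ℕ → Site d, ENNReal.ofReal
          (Real.exp (-s * ((stepPath z X (n + 1) ⬝ᵥ u : ℤ) : ℝ))) =
          ENNReal.ofReal (Real.exp (-s * ((z ⬝ᵥ u : ℤ) : ℝ))) *
            ENNReal.ofReal (Real.exp (-s * ((X n ⬝ᵥ u : ℤ) : ℝ))) := fun X => by
        rw [← ENNReal.ofReal_mul (Real.exp_pos _).le, ← Real.exp_add]
        simp only [stepPath, add_dotProduct]
        push_cast
        ring_nf
      simp only [this]
      rw [lintegral_const_mul _ (hm n), mul_assoc]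
      gcongr
      exact ih (hΓ ω hω z hz)
    refine (ENNReal.tsum_le_tsum hstep).trans ?_
    rw [ENNReal.tsum_mul_right, pow_succ']
    gcongr
    exact hρ ω hω

/-- Under (N) and (M) the walk is transient in direction `u`. -/
theorem ae_transient {d : ℕ} {u : Site d} {μ : Measure (Env d)} (hμ : StepStable μ)
    (hN : HypothesisN u μ) (hM : HypothesisM μ) :
    ∀ᵐ ω ∂μ, ∀ᵐ X ∂pathLaw ω, Tendsto (fun n => X n ⬝ᵥ u) atTop atTop := by
  obtain ⟨δ, hδ, hN⟩ := hN
  obtain ⟨M, s₀, -, hs₀, hM⟩ := hM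
  obtain ⟨s, hs, ρ, hρ, hcon⟩ := exists_contraction u (M := M) hδ hs₀
  obtain ⟨Γ, hΓ, hq, hcl⟩ := hμ.exists_stepClosed (hN.and hM)
  filter_upwards [hΓ] with ω hω
  have hbound := fun n => lintegral_exp_path_le u s ρ hcl
    (fun ω hω => hcon (ω 0) (hq ω hω).1 (hq ω hω).2) n hω
  have hm : ∀ n, Measurable fun X : ℕ → Site d =>
      ENNReal.ofReal (Real.exp (-s * ((X n ⬝ᵥ u : ℤ) : ℝ))) := fun n =>
    (measurable_of_countable fun x : Site d =>
      ENNReal.ofReal (Real.exp (-s * ((x ⬝ᵥ u : ℤ) : ℝ)))).comp (measurable_pi_apply n)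
  -- The geometric bounds are summable, so almost surely the exponentials themselves are summable
  -- and tend to `0`, which forces `X n · u` to infinity.
  have hfin : ∫⁻ X, ∑' n, ENNReal.ofReal (Real.exp (-s * ((X n ⬝ᵥ u : ℤ) : ℝ))) ∂pathLaw ω ≠ ∞ := by
    rw [lintegral_tsum fun n => (hm n).aemeasurable]
    refine ne_top_of_le_ne_top ?_ (ENNReal.tsum_le_tsum hbound)
    rw [ENNReal.tsum_geometric]
    exact ENNReal.inv_ne_top.2 (tsub_pos_of_lt hρ).ne'
  filter_upwards [ae_lt_top (Measurable.tsum hm) hfin] with X hX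
  have h0 := ENNReal.tendsto_atTop_zero_of_tsum_ne_top hX.ne
  refine tendsto_atTop.2 fun m => ?_
  have hpos : 0 < ENNReal.ofReal (Real.exp (-s * (m : ℝ))) := ENNReal.ofReal_pos.2 (Real.exp_pos _)
  filter_upwards [h0.eventually (gt_mem_nhds hpos)] with n hn
  have h1 := Real.exp_lt_exp.1 ((ENNReal.ofReal_lt_ofReal_iff (Real.exp_pos _)).1 hn)
  have h2 : (m : ℝ) < ((X n ⬝ᵥ u : ℤ) : ℝ) := by nlinarith
  exact_mod_cast h2.le

/-! ### Test functions on the Skorohod space -/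

/-- The truncated distance from `y` to `g t`, damped at large times. -/
noncomputable def gap {d : ℕ} (g : ℝ≥0 → Space d) (t : ℝ≥0) (y : Space d) : ℝ :=
  (1 + (t : ℝ))⁻¹ * min 1 (dist y (g t))

theorem gap_nonneg {d : ℕ} (g : ℝ≥0 → Space d) (t : ℝ≥0) (y : Space d) : 0 ≤ gap g t y :=
  mul_nonneg (by positivity) (le_min zero_le_one dist_nonneg)

theorem gap_le_inv {d : ℕ} (g : ℝ≥0 → Space d) (t : ℝ≥0) (y : Space d) :
    gap g t y ≤ (1 + (t : ℝ))⁻¹ :=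
  mul_le_of_le_one_right (by positivity) (min_le_left _ _)

theorem gap_le_inv_of_le {d : ℕ} (g : ℝ≥0 → Space d) {T t : ℝ≥0} (h : T ≤ t) (y : Space d) :
    gap g t y ≤ (1 + (T : ℝ))⁻¹ :=
  (gap_le_inv g t y).trans (inv_anti₀ (by positivity) (by gcongr))

theorem gap_le_one {d : ℕ} (g : ℝ≥0 → Space d) (t : ℝ≥0) (y : Space d) : gap g t y ≤ 1 := by
  simpa using gap_le_inv_of_le g (zero_le (a := t)) y

theorem gap_le_dist {d : ℕ} (g : ℝ≥0 → Space d) (t : ℝ≥0) (y : Space d) :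
    gap g t y ≤ dist y (g t) := by
  refine (mul_le_of_le_one_left (le_min zero_le_one dist_nonneg) ?_).trans (min_le_right _ _)
  exact inv_le_one_of_one_le₀ (by simp)

theorem exists_inv_le {ε : ℝ} (hε : 0 < ε) : ∃ T : ℝ≥0, (1 + (T : ℝ))⁻¹ ≤ ε := by
  refine ⟨ε⁻¹.toNNReal, ?_⟩
  rw [Real.coe_toNNReal _ (inv_pos.2 hε).le, inv_le_comm₀ (by positivity) hε]
  linarith

theorem abs_gap_sub_le {d : ℕ} (g : ℝ≥0 → Space d) (t t' : ℝ≥0) (y y' : Space d) :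
    |gap g t y - gap g t' y'| ≤ dist t t' + (dist y y' + dist (g t) (g t')) := by
  set w := (1 + (t : ℝ))⁻¹ with hw
  set w' := (1 + (t' : ℝ))⁻¹ with hw'
  set m := min 1 (dist y (g t)) with hm
  set m' := min 1 (dist y' (g t')) with hm'
  have ht : (0 : ℝ) ≤ t := t.2
  have ht' : (0 : ℝ) ≤ t' := t'.2
  have h1 : |w - w'| ≤ dist t t' := by
    have : w - w' = (t' - t) * (w * w') := by
      rw [hw, hw']
      field_simp
      ring
    rw [this, abs_mul, NNReal.dist_eq, abs_sub_comm]
    refine mul_le_of_le_one_right (abs_nonneg _) ?_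
    have hw1 : w ≤ 1 := inv_le_one_of_one_le₀ (by simp)
    have hw1' : w' ≤ 1 := inv_le_one_of_one_le₀ (by simp)
    rw [abs_of_nonneg (by positivity)]
    exact mul_le_one₀ hw1 (by positivity) hw1'
  have h2 : |m - m'| ≤ dist y y' + dist (g t) (g t') := by
    refine (abs_min_sub_min_le_max _ _ _ _).trans ?_
    rw [sub_self, abs_zero, max_eq_right (abs_nonneg _)]
    exact dist_dist_dist_le _ _ _ _
  have hm0 : |m| ≤ 1 := by
    rw [abs_of_nonneg (le_min zero_le_one dist_nonneg)]; exact min_le_left _ _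
  have hw0 : |w'| ≤ 1 := by
    rw [abs_of_nonneg (by positivity)]; exact inv_le_one_of_one_le₀ (by simp)
  calc |gap g t y - gap g t' y'| = |(w - w') * m + w' * (m - m')| := by
        congr 1; simp only [gap, ← hw, ← hw', ← hm, ← hm']; ring
    _ ≤ |(w - w') * m| + |w' * (m - m')| := abs_add_le _ _
    _ ≤ |w - w'| + |m - m'| := by
      rw [abs_mul, abs_mul]
      exact add_le_add (mul_le_of_le_one_right (abs_nonneg _) hm0)
        (mul_le_of_le_one_left (abs_nonneg _) hw0)
    _ ≤ _ := add_le_add h1 h2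

/-- Up to time `T + 1` the path `g` is uniformly continuous; if either time exceeds `T + 1`, both
exceed `T` and the damping makes both gaps at most `ε`. -/
theorem exists_gap_close {d : ℕ} {g : ℝ≥0 → Space d} (hg : Continuous g) {ε : ℝ} (hε : 0 < ε) :
    ∃ η > 0, ∀ t t' y y', dist t t' < η → dist y y' < η → |gap g t y - gap g t' y'| ≤ ε := by
  obtain ⟨T, hT⟩ := exists_inv_le hε
  have hu : UniformContinuousOn g (Set.Icc 0 (T + 1)) :=
    isCompact_Icc.uniformContinuousOn_of_continuous hg.continuousOn
  obtain ⟨η, hη, h⟩ := Metric.uniformContinuousOn_iff.1 hu (ε / 3) (by positivity)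
  refine ⟨min 1 (min η (ε / 3)), by positivity, fun t t' y y' ht hy => ?_⟩
  have ht1 := ht.trans_le (min_le_left _ _)
  have ht2 := ht.trans_le ((min_le_right _ _).trans (min_le_left _ _))
  have ht3 := ht.trans_le ((min_le_right _ _).trans (min_le_right _ _))
  have hy3 := hy.trans_le ((min_le_right _ _).trans (min_le_right _ _))
  by_cases hc : t ≤ T + 1 ∧ t' ≤ T + 1
  · have := h t ⟨zero_le, hc.1⟩ t' ⟨zero_le, hc.2⟩ ht2
    have := abs_gap_sub_le g t t' y y'
    linarith
  · have hTT : T ≤ t ∧ T ≤ t' := by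
      rw [NNReal.dist_eq, abs_lt] at ht1
      rw [not_and_or, not_le, not_le] at hc
      simp only [← NNReal.coe_le_coe, ← NNReal.coe_lt_coe, NNReal.coe_add, NNReal.coe_one] at hc ⊢
      rcases hc with hc | hc <;> constructor <;> linarith
    have h1 := gap_nonneg g t y
    have h2 := gap_nonneg g t' y'
    have h3 := gap_le_inv_of_le g hTT.1 y
    have h4 := gap_le_inv_of_le g hTT.2 y'
    rw [abs_le]
    constructor <;> linarith

/-- A bounded distance of locally uniform convergence. -/
noncomputable def pathGap {d : ℕ} (g h : ℝ≥0 → Space d) : ℝ := ⨆ t, gap g t (h t)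

theorem bddAbove_gap {d : ℕ} (g h : ℝ≥0 → Space d) :
    BddAbove (Set.range fun t => gap g t (h t)) :=
  ⟨1, Set.forall_mem_range.2 fun t => gap_le_one g t _⟩

theorem gap_le_pathGap {d : ℕ} (g h : ℝ≥0 → Space d) (t : ℝ≥0) : gap g t (h t) ≤ pathGap g h :=
  le_ciSup (bddAbove_gap g h) t

theorem pathGap_le_add {d : ℕ} {g h h' : ℝ≥0 → Space d} {ε : ℝ}
    (H : ∀ t, ∃ t', gap g t (h t) ≤ gap g t' (h' t') + ε) : pathGap g h ≤ pathGap g h' + ε := by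
  refine ciSup_le fun t => ?_
  obtain ⟨t', ht'⟩ := H t
  exact ht'.trans (add_le_add_left (gap_le_pathGap g h' t') ε)

/-- A time change carries `(t, k t)` close to `(τ t, f (τ t))`, and continuity of `g` makes the gap
insensitive to this; the supremum over all times absorbs the reparametrization. -/
theorem continuous_pathGap {d : ℕ} {g : ℝ≥0 → Space d} (hg : Continuous g) :
    Continuous fun h : SkorohodSpace d => pathGap g h.1 := by
  refine continuous_def.2 fun U hU f hf => ?_
  obtain ⟨r, hr, hball⟩ := Metric.isOpen_iff.1 hU _ hf
  obtain ⟨T, hT⟩ := exists_inv_le (half_pos hr)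
  obtain ⟨η, hη, hclose⟩ := exists_gap_close hg (half_pos hr)
  -- The bound `1` on `|τ t - t|` ensures `τ (T + 1) ≥ T`, so beyond `T + 1` both sides of the
  -- comparison are in the damped range.
  refine ⟨T + 1, min η 1, by positivity, ?_⟩
  rintro k ⟨τ, hτ⟩
  refine hball ?_
  have hnear : ∀ t ≤ T + 1, |gap g t (k t) - gap g (τ t) (f (τ t))| ≤ r / 2 := fun t ht =>
    hclose _ _ _ _ (by rw [dist_comm]; exact (hτ t ht).1.trans_le (min_le_left _ _))
      ((hτ t ht).2.trans_le (min_le_left _ _))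
  have hTτ : T ≤ τ (T + 1) := by
    have h1 := (hτ (T + 1) le_rfl).1.trans_le (min_le_right _ _)
    rw [NNReal.dist_eq, abs_lt] at h1
    have h2 := h1.1
    rw [← NNReal.coe_le_coe]
    push_cast at h2
    linarith
  have hle1 : pathGap g k.1 ≤ pathGap g f.1 + r / 2 := by
    refine pathGap_le_add fun t => ⟨τ t, ?_⟩
    rcases le_total t (T + 1) with ht | ht
    · have := (abs_le.1 (hnear t ht)).2
      linarith
    · have := gap_le_inv_of_le g ((le_self_add : T ≤ T + 1).trans ht) (k t)
      have := gap_nonneg g (τ t) (f (τ t))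
      linarith
  have hle2 : pathGap g f.1 ≤ pathGap g k.1 + r / 2 := by
    refine pathGap_le_add fun s => ⟨τ.symm s, ?_⟩
    obtain ⟨t, rfl⟩ := τ.surjective s
    rw [τ.symm_apply_apply]
    rcases le_total t (T + 1) with ht | ht
    · have := (abs_le.1 (hnear t ht)).1
      linarith
    · have := gap_le_inv_of_le g (hTτ.trans (τ.monotone ht)) (f (τ t))
      have := gap_nonneg g t (k t)
      linarith
  rw [Metric.mem_ball, Real.dist_eq, abs_lt]
  constructor <;> linarith

/-- A sequence that is dense in the continuous paths. -/
noncomputable def densePath (d : ℕ) (i : ℕ) : C(ℝ≥0, Space d) := TopologicalSpace.denseSeq _ i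

/-- With the identity time change, a Skorohod neighbourhood of `f` contains a locally uniform one. A
member of the dense sequence close to the continuous path `f` therefore gives a `pathGap` ball
around it that contains `f` and lies in `U`; the radius is under half of the gap tolerated up to
time `T`. -/
theorem exists_densePath_subset {d : ℕ} {U : Set (SkorohodSpace d)} (hU : IsOpen U)
    {f : SkorohodSpace d} (hf : f ∈ U) (hc : Continuous f.1) :
    ∃ i : ℕ × ℕ, pathGap (densePath d i.1) f.1 < 1 / ((i.2 : ℝ) + 1) ∧
      {h : SkorohodSpace d | pathGap (densePath d i.1) h.1 < 1 / ((i.2 : ℝ) + 1)} ⊆ U := by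
  obtain ⟨T, ε, hε, hsub⟩ := hU f hf
  have hw : 0 < (1 + (T : ℝ))⁻¹ * min 1 ε := by positivity
  obtain ⟨m, hm⟩ := exists_nat_one_div_lt (half_pos hw)
  have hm0 : (0 : ℝ) < 1 / ((m : ℝ) + 1) := by positivity
  obtain ⟨T', hT'⟩ := exists_inv_le (half_pos hm0)
  have hnhds := Metric.tendstoUniformlyOn_iff.1
    (ContinuousMap.tendsto_iff_forall_isCompact_tendstoUniformlyOn.1
      (tendsto_id (x := 𝓝 (⟨f.1, hc⟩ : C(ℝ≥0, Space d)))) (Set.Icc 0 T') isCompact_Icc)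
    _ (half_pos hm0)
  obtain ⟨i, hi⟩ := (TopologicalSpace.denseRange_denseSeq C(ℝ≥0, Space d)).mem_nhds hnhds
  refine ⟨(i, m), ?_, fun h hh => hsub ⟨OrderIso.refl _, fun t ht => ⟨by simpa using hε, ?_⟩⟩⟩
  · refine lt_of_le_of_lt (ciSup_le fun t => ?_) (half_lt_self hm0)
    rcases le_total t T' with ht | ht
    · exact (gap_le_dist _ _ _).trans (hi t ⟨zero_le, ht⟩).le
    · exact (gap_le_inv_of_le _ ht _).trans hT'
  · have h1 := (gap_le_pathGap (densePath d i) h.1 t).trans_lt hh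
    have h2 : gap (densePath d i) t (f.1 t) ≤ 1 / ((m : ℝ) + 1) / 2 := by
      rcases le_total t T' with ht | ht
      · exact (gap_le_dist _ _ _).trans (hi t ⟨zero_le, ht⟩).le
      · exact (gap_le_inv_of_le _ ht _).trans hT'
    have hwt : (1 + (T : ℝ))⁻¹ ≤ (1 + (t : ℝ))⁻¹ := inv_anti₀ (by positivity) (by gcongr)
    have h3 : (1 + (t : ℝ))⁻¹ * min 1 (dist (h.1 t) (f.1 t)) < (1 + (t : ℝ))⁻¹ * min 1 ε := by
      have h4 : min 1 (dist (h.1 t) (f.1 t)) ≤ min 1 (dist (h.1 t) (densePath d i t)) +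
          min 1 (dist (f.1 t) (densePath d i t)) := by
        have h5 := dist_triangle_right (h.1 t) (f.1 t) (densePath d i t)
        have h6 : 0 ≤ dist (h.1 t) (densePath d i t) := dist_nonneg
        have h7 : 0 ≤ dist (f.1 t) (densePath d i t) := dist_nonneg
        rcases le_total 1 (dist (h.1 t) (densePath d i t)) with h8 | h8
        · rw [min_eq_left h8]
          exact (min_le_left _ _).trans (le_add_of_nonneg_right (le_min zero_le_one h7))
        · rcases le_total 1 (dist (f.1 t) (densePath d i t)) with h9 | h9
          · rw [min_eq_left h9]
            exact (min_le_left _ _).trans (le_add_of_nonneg_left (le_min zero_le_one h6))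
          · rw [min_eq_right h8, min_eq_right h9]
            exact (min_le_right _ _).trans h5
      calc (1 + (t : ℝ))⁻¹ * min 1 (dist (h.1 t) (f.1 t))
          ≤ gap (densePath d i) t (h.1 t) + gap (densePath d i) t (f.1 t) := by
            rw [gap, gap, ← mul_add]
            exact mul_le_mul_of_nonneg_left h4 (by positivity)
        _ < (1 + (T : ℝ))⁻¹ * min 1 ε := by
          simp only at h1
          linarith
        _ ≤ _ := mul_le_mul_of_nonneg_right hwt (by positivity)
    have h4 := lt_of_mul_lt_mul_left h3 (by positivity)
    by_contra hcon
    exact absurd h4 (not_lt.2 (min_le_min_left 1 (not_lt.1 hcon)))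

/-- The countable family of test functions. -/
noncomputable def testFun {d : ℕ} (i : Finset (ℕ × ℕ) × ℕ) (h : ℝ≥0 → Space d) : ℝ :=
  min 1 ((i.2 : ℝ) * ∑ j ∈ i.1, max 0 (1 / ((j.2 : ℝ) + 1) - pathGap (densePath d j.1) h))

theorem testFun_nonneg {d : ℕ} (i : Finset (ℕ × ℕ) × ℕ) (h : ℝ≥0 → Space d) : 0 ≤ testFun i h :=
  le_min zero_le_one <| mul_nonneg (Nat.cast_nonneg _) <|
    Finset.sum_nonneg fun _ _ => le_max_left _ _

theorem testFun_le_one {d : ℕ} (i : Finset (ℕ × ℕ) × ℕ) (h : ℝ≥0 → Space d) : testFun i h ≤ 1 :=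
  min_le_left _ _

theorem continuous_testFun {d : ℕ} (i : Finset (ℕ × ℕ) × ℕ) :
    Continuous fun h : SkorohodSpace d => testFun i h.1 :=
  continuous_const.min <| continuous_const.mul <| continuous_finsetSum _ fun j _ =>
    continuous_const.max <| continuous_const.sub <| continuous_pathGap (densePath d j.1).continuous

theorem abs_testFun_sub_le {d : ℕ} (i : Finset (ℕ × ℕ) × ℕ) (h h' : ℝ≥0 → Space d) :
    |testFun i h - testFun i h'| ≤
      (i.2 : ℝ) * ∑ j ∈ i.1, |pathGap (densePath d j.1) h - pathGap (densePath d j.1) h'| := by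
  refine (abs_min_sub_min_le_max _ _ _ _).trans ?_
  rw [sub_self, abs_zero, max_eq_right (abs_nonneg _), ← mul_sub, abs_mul, Nat.abs_cast,
    ← Finset.sum_sub_distrib]
  refine mul_le_mul_of_nonneg_left ((Finset.abs_sum_le_sum_abs _ _).trans
    (Finset.sum_le_sum fun j _ => ?_)) (Nat.cast_nonneg _)
  refine (abs_max_sub_max_le_max _ _ _ _).trans ?_
  rw [sub_self, abs_zero, max_eq_right (abs_nonneg _), sub_sub_sub_cancel_left, abs_sub_comm]

theorem tendsto_integral_testFun {d : ℕ} {Q : ℕ → ProbabilityMeasure (SkorohodSpace d)}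
    {W : ProbabilityMeasure (SkorohodSpace d)} (h : Tendsto Q atTop (𝓝 W))
    (i : Finset (ℕ × ℕ) × ℕ) :
    Tendsto (fun n => ∫ f, testFun i f.1 ∂(Q n : Measure (SkorohodSpace d))) atTop
      (𝓝 (∫ f, testFun i f.1 ∂(W : Measure (SkorohodSpace d)))) :=
  ProbabilityMeasure.tendsto_iff_forall_integral_tendsto.1 h
    (BoundedContinuousFunction.ofNormedAddCommGroup (fun f : SkorohodSpace d => testFun i f.1)
      (continuous_testFun i) 1 fun f => by
        rw [Real.norm_eq_abs, abs_of_nonneg (testFun_nonneg i _)]; exact testFun_le_one i _)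

theorem integrable_testFun {d : ℕ} (i : Finset (ℕ × ℕ) × ℕ) (Q : Measure (SkorohodSpace d))
    [IsFiniteMeasure Q] : Integrable (fun f : SkorohodSpace d => testFun i f.1) Q :=
  Integrable.of_bound (continuous_testFun i).measurable.aestronglyMeasurable 1
    (Eventually.of_forall fun f => by
      rw [Real.norm_eq_abs, abs_of_nonneg (testFun_nonneg i _)]; exact testFun_le_one i _)

/-- The test functions determine weak convergence to a law on continuous paths. -/
theorem tendsto_of_forall_testFun {d : ℕ} {Q : ℕ → ProbabilityMeasure (SkorohodSpace d)}
    {W : ProbabilityMeasure (SkorohodSpace d)}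
    (hc : ∀ᵐ f ∂(W : Measure (SkorohodSpace d)), Continuous f.1)
    (h : ∀ i, Tendsto (fun n => ∫ f, testFun i f.1 ∂(Q n : Measure (SkorohodSpace d))) atTop
      (𝓝 (∫ f, testFun i f.1 ∂(W : Measure (SkorohodSpace d))))) :
    Tendsto Q atTop (𝓝 W) := by
  classical
  -- By the portmanteau theorem, open sets suffice. The test functions for `I m` vanish off `U` and
  -- are eventually `1` at each continuous path in `U`; Fatou's lemma then compares `W U` with the
  -- limits of their integrals.
  refine tendsto_of_forall_isOpen_le_liminf' fun U hU => ?_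
  let J : Set (ℕ × ℕ) :=
    {j | {h : SkorohodSpace d | pathGap (densePath d j.1) h.1 < 1 / ((j.2 : ℝ) + 1)} ⊆ U}
  let I : ℕ → Finset (ℕ × ℕ) × ℕ := fun m =>
    ((Finset.range m ×ˢ Finset.range m).filter (· ∈ J), m)
  have hle : ∀ m (f : SkorohodSpace d),
      ENNReal.ofReal (testFun (I m) f.1) ≤ U.indicator 1 f := fun m f => by
    by_cases hf : f ∈ U
    · rw [Set.indicator_of_mem hf]
      exact ENNReal.ofReal_le_one.2 (testFun_le_one _ _)
    · rw [Set.indicator_of_notMem hf]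
      refine le_of_eq (ENNReal.ofReal_eq_zero.2 ?_)
      refine (min_le_right _ _).trans (le_of_eq ?_)
      rw [Finset.sum_eq_zero, mul_zero]
      intro j hj
      have hjJ : j ∈ J := (Finset.mem_filter.1 hj).2
      refine max_eq_left (sub_nonpos.2 (not_lt.1 fun hlt => hf (hjJ hlt)))
  have hm : ∀ m, Measurable fun f : SkorohodSpace d => ENNReal.ofReal (testFun (I m) f.1) :=
    fun m => (continuous_testFun (I m)).measurable.ennreal_ofReal
  have hof : ∀ m (R : ProbabilityMeasure (SkorohodSpace d)),
      ∫⁻ f, ENNReal.ofReal (testFun (I m) f.1) ∂(R : Measure (SkorohodSpace d)) =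
        ENNReal.ofReal (∫ f, testFun (I m) f.1 ∂(R : Measure (SkorohodSpace d))) := fun m R =>
    (ofReal_integral_eq_lintegral_ofReal (integrable_testFun _ _)
      (Eventually.of_forall fun f => testFun_nonneg _ _)).symm
  have hbound : ∀ m, ∫⁻ f, ENNReal.ofReal (testFun (I m) f.1) ∂(W : Measure (SkorohodSpace d)) ≤
      liminf (fun n => (Q n : Measure (SkorohodSpace d)) U) atTop := fun m => by
    rw [hof, ← ((ENNReal.continuous_ofReal.tendsto _).comp (h (I m))).liminf_eq]
    refine liminf_le_liminf (Eventually.of_forall fun n => ?_)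
    rw [Function.comp_apply, ← hof, ← lintegral_indicator_one hU.measurableSet]
    exact lintegral_mono (hle m)
  calc (W : Measure (SkorohodSpace d)) U
      = ∫⁻ f, U.indicator 1 f ∂(W : Measure (SkorohodSpace d)) :=
        (lintegral_indicator_one hU.measurableSet).symm
    _ ≤ ∫⁻ f, liminf (fun m => ENNReal.ofReal (testFun (I m) f.1)) atTop
          ∂(W : Measure (SkorohodSpace d)) := by
        refine lintegral_mono_ae ?_
        filter_upwards [hc] with f hfc
        by_cases hf : f ∈ U
        swap
        · rw [Set.indicator_of_notMem hf]; exact zero_le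
        rw [Set.indicator_of_mem hf]
        obtain ⟨j, hj, hjU⟩ := exists_densePath_subset hU hf hfc
        refine le_liminf_of_le (by isBoundedDefault) ?_
        obtain ⟨m₀, hm₀⟩ := exists_nat_ge
          (1 / (1 / ((j.2 : ℝ) + 1) - pathGap (densePath d j.1) f.1))
        filter_upwards [eventually_ge_atTop (max m₀ (max j.1 j.2 + 1))] with m hm
        have hm1 : m₀ ≤ m := (le_max_left _ _).trans hm
        have hm2 : max j.1 j.2 < m := (le_max_right _ _).trans hm
        have hjm : j ∈ (I m).1 := Finset.mem_filter.2 ⟨Finset.mem_product.2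
          ⟨Finset.mem_range.2 ((le_max_left _ _).trans_lt hm2),
            Finset.mem_range.2 ((le_max_right _ _).trans_lt hm2)⟩, hjU⟩
        have hpos : 0 < 1 / ((j.2 : ℝ) + 1) - pathGap (densePath d j.1) f.1 := sub_pos.2 hj
        have h1 : 1 / ((j.2 : ℝ) + 1) - pathGap (densePath d j.1) f.1 ≤
            ∑ j ∈ (I m).1, max 0 (1 / ((j.2 : ℝ) + 1) - pathGap (densePath d j.1) f.1) :=
          (le_max_right 0 _).trans (Finset.single_le_sum
            (f := fun j : ℕ × ℕ => max 0 (1 / ((j.2 : ℝ) + 1) - pathGap (densePath d j.1) f.1))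
            (fun _ _ => le_max_left _ _) hjm)
        have h2 : (1 : ℝ) ≤ m * ∑ j ∈ (I m).1,
            max 0 (1 / ((j.2 : ℝ) + 1) - pathGap (densePath d j.1) f.1) := by
          rw [div_le_iff₀ hpos] at hm₀
          refine hm₀.trans (mul_le_mul (by exact_mod_cast hm1) h1 hpos.le (Nat.cast_nonneg _))
        have h3 : testFun (I m) f.1 = 1 := min_eq_left h2
        rw [h3]
        simp
    _ ≤ liminf (fun m => ∫⁻ f, ENNReal.ofReal (testFun (I m) f.1)
          ∂(W : Measure (SkorohodSpace d))) atTop := lintegral_liminf_le hm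
    _ ≤ liminf (fun n => (Q n : Measure (SkorohodSpace d)) U) atTop :=
        liminf_le_of_le (by isBoundedDefault) fun b hb => by
          obtain ⟨m, hm⟩ := hb.exists
          exact hm.trans (hbound m)

/-! ### The scaled walk forgets an initial piece of the path -/

/-- The increments of the path after time `k`. -/
def increments {d : ℕ} (k : ℕ) (X : ℕ → Site d) (j : ℕ) : Site d := X (k + j) - X k

theorem increments_succ {d : ℕ} (k : ℕ) (X : ℕ → Site d) :
    increments (k + 1) X = increments 1 (increments k X) := by
  funext j
  simp only [increments]
  rw [← add_assoc]
  abel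

theorem increments_splice {d : ℕ} (k : ℕ) (X : ℕ → Site d) {Y : ℕ → Site d} (hY : Y 0 = 0) :
    increments k (splice k X Y) = Y := by
  funext j
  cases j with
  | zero => simp [increments, hY]
  | succ j => simp [increments, splice]

theorem toSpace_sub {d : ℕ} (x y : Site d) : toSpace (x - y) = toSpace x - toSpace y := by
  ext i; simp [toSpace]

theorem toSpace_zero {d : ℕ} : toSpace (0 : Site d) = 0 := by
  ext i; simp [toSpace]

theorem dist_scaledFun_le {d : ℕ} (v : Space d) {n : ℕ} (hn : n ≠ 0) {X : ℕ → Site d}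
    (hX : X 0 = 0) (t : ℝ≥0) :
    dist (scaledFun v n X t) (scaledFun v n (increments 1 X) (t - (n : ℝ≥0)⁻¹)) ≤
      (Real.sqrt n)⁻¹ * ‖toSpace (X 1) - v‖ := by
  have hn0 : (n : ℝ≥0) ≠ 0 := Nat.cast_ne_zero.2 hn
  -- Delaying by `1 / n` removes one step. Both subtractions are truncated at `0`, and consistently
  -- so: before time `1 / n` both scaled paths sit at `0`.
  have hfl : ⌊(n : ℝ≥0) * (t - (n : ℝ≥0)⁻¹)⌋₊ = ⌊(n : ℝ≥0) * t⌋₊ - 1 := by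
    rw [mul_tsub, mul_inv_cancel₀ hn0, Nat.floor_sub_one]
  unfold scaledFun
  rw [hfl]
  cases ⌊(n : ℝ≥0) * t⌋₊ with
  | zero =>
    simp only [increments, hX, Nat.zero_sub, toSpace_sub, toSpace_zero, dist_eq_norm]
    simp
    positivity
  | succ j =>
    rw [Nat.add_sub_cancel, dist_eq_norm, ← smul_sub, norm_smul, Real.norm_eq_abs,
      abs_of_nonneg (by positivity), increments, toSpace_sub, add_comm 1 j]
    refine le_of_eq ?_
    congr 2
    push_cast
    rw [add_smul, one_smul]
    abel

/-- Dropping the first step is a time shift by `1 / n` together with a displacement of order `1 /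
√n`, and `pathGap` with a continuous `g` is insensitive to both. -/
theorem tendsto_pathGap_increments {d : ℕ} {g : ℝ≥0 → Space d} (hg : Continuous g) (v : Space d)
    {X : ℕ → Site d} (hX : X 0 = 0) :
    Tendsto (fun n => |pathGap g (scaledFun v n X) - pathGap g (scaledFun v n (increments 1 X))|)
      atTop (𝓝 0) := by
  refine Metric.tendsto_nhds.2 fun ε hε => ?_
  obtain ⟨η, hη, hclose⟩ := exists_gap_close hg (half_pos hε)
  have h1 : Tendsto (fun n : ℕ => ((n : ℝ))⁻¹) atTop (𝓝 0) := tendsto_inv_atTop_nhds_zero_nat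
  have h2 : Tendsto (fun n : ℕ => (Real.sqrt n)⁻¹ * ‖toSpace (X 1) - v‖) atTop (𝓝 0) := by
    have := (Real.tendsto_sqrt_atTop.comp tendsto_natCast_atTop_atTop).inv_tendsto_atTop.mul_const
      ‖toSpace (X 1) - v‖
    simpa using this
  filter_upwards [h1.eventually (gt_mem_nhds hη), h2.eventually (gt_mem_nhds hη),
    eventually_ne_atTop 0] with n hn1 hn2 hn0
  have hnear : ∀ t : ℝ≥0, |gap g t (scaledFun v n X t) - gap g (t - (n : ℝ≥0)⁻¹)
      (scaledFun v n (increments 1 X) (t - (n : ℝ≥0)⁻¹))| ≤ ε / 2 := fun t =>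
    hclose _ _ _ _ (by
      refine lt_of_le_of_lt ?_ hn1
      rw [NNReal.dist_eq, abs_le]
      have h3 : ((t - (n : ℝ≥0)⁻¹ : ℝ≥0) : ℝ) ≤ t := NNReal.coe_le_coe.2 tsub_le_self
      have h4 : (t : ℝ) ≤ ((t - (n : ℝ≥0)⁻¹ : ℝ≥0) : ℝ) + (n : ℝ)⁻¹ := by
        have : t ≤ t - (n : ℝ≥0)⁻¹ + (n : ℝ≥0)⁻¹ := le_tsub_add
        exact_mod_cast this
      have h5 : (0 : ℝ) ≤ (n : ℝ)⁻¹ := by positivity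
      constructor <;> linarith)
      ((dist_scaledFun_le v hn0 hX t).trans_lt hn2)
  have hle1 : pathGap g (scaledFun v n X) ≤ pathGap g (scaledFun v n (increments 1 X)) + ε / 2 := by
    refine pathGap_le_add fun t => ⟨t - (n : ℝ≥0)⁻¹, ?_⟩
    have := (abs_le.1 (hnear t)).2
    linarith
  have hle2 : pathGap g (scaledFun v n (increments 1 X)) ≤ pathGap g (scaledFun v n X) + ε / 2 := by
    refine pathGap_le_add fun t => ⟨t + (n : ℝ≥0)⁻¹, ?_⟩
    have := (abs_le.1 (hnear (t + (n : ℝ≥0)⁻¹))).1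
    rw [add_tsub_cancel_right] at this
    linarith
  rw [Real.dist_eq, sub_zero, abs_abs]
  refine lt_of_le_of_lt (abs_le.2 ⟨?_, ?_⟩) (half_lt_self hε) <;> linarith

theorem tendsto_testFun_increments {d : ℕ} (i : Finset (ℕ × ℕ) × ℕ) (v : Space d)
    {X : ℕ → Site d} (hX : X 0 = 0) (k : ℕ) :
    Tendsto (fun n => testFun i (scaledFun v n X) - testFun i (scaledFun v n (increments k X)))
      atTop (𝓝 0) := by
  induction k with
  | zero =>
    have : increments 0 X = X := by funext j; simp [increments, hX]
    simp [this]
  | succ k ih =>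
    have h0 : increments k X 0 = 0 := by simp [increments]
    have hstep : Tendsto (fun n => testFun i (scaledFun v n (increments k X)) -
        testFun i (scaledFun v n (increments (k + 1) X))) atTop (𝓝 0) := by
      rw [increments_succ]
      refine squeeze_zero_norm (fun n => abs_testFun_sub_le i _ _) ?_
      have := (tendsto_finsetSum i.1 fun j _ =>
        tendsto_pathGap_increments (densePath d j.1).continuous v h0).const_mul (i.2 : ℝ)
      simpa using this
    simpa using ih.add hstep

/-! ### Limits of expectations over pieces of the path space -/

theorem measurable_increments {d : ℕ} (k : ℕ) :
    Measurable (increments k : (ℕ → Site d) → ℕ → Site d) := by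
  refine measurable_pi_lambda _ fun j => ?_
  have : Measurable fun q : Site d × Site d => q.1 - q.2 := measurable_of_countable _
  have h' : Measurable fun X : ℕ → Site d => (X (k + j), X k) :=
    (measurable_pi_apply _).prodMk (measurable_pi_apply _)
  exact this.comp h'

/-- The Markov property for an event up to time `k` and the increments after `k`. -/
theorem setLIntegral_increments {d : ℕ} (k : ℕ) (ω : Env d) {C : Set (ℕ → Site d)}
    (hC : MeasurableSet C) (hdep : ∀ X Y : ℕ → Site d, (∀ j ≤ k, X j = Y j) → X ∈ C → Y ∈ C)
    {G : (ℕ → Site d) → ℝ≥0∞} (hG : Measurable G) :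
    ∫⁻ X in C, G (increments k X) ∂pathLaw ω =
      ∫⁻ X in C, ∫⁻ Y, G Y ∂pathLaw (shift (X k) ω) ∂pathLaw ω := by
  have hsplice : ∀ X Y : ℕ → Site d, splice k X Y ∈ C ↔ X ∈ C := fun X Y => by
    have : ∀ j ≤ k, splice k X Y j = X j := fun j hj => by simp [splice, hj]
    exact ⟨hdep _ _ this, hdep _ _ fun j hj => (this j hj).symm⟩
  rw [← lintegral_indicator hC, ← lintegral_indicator hC,
    lintegral_markov k ω (Φ := C.indicator fun X => G (increments k X))
      ((hG.comp (measurable_increments k)).indicator hC)]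
  refine lintegral_congr fun X => ?_
  by_cases hX : X ∈ C
  · rw [Set.indicator_of_mem hX]
    refine lintegral_congr_ae ?_
    filter_upwards [ae_path_zero (shift (X k) ω)] with Y hY
    rw [Set.indicator_of_mem ((hsplice X Y).2 hX), increments_splice k X hY]
  · rw [Set.indicator_of_notMem hX]
    simp only [Set.indicator_of_notMem (mt (hsplice X _).1 hX), lintegral_zero]

/-- A sequence of `[0,1]`-valued path functionals that asymptotically depend only on the
increments after any fixed time. -/
structure Forgetful {d : ℕ} (φ : ℕ → (ℕ → Site d) → ℝ) : Prop where
  measurable : ∀ n, Measurable (φ n)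
  nonneg : ∀ n X, 0 ≤ φ n X
  le_one : ∀ n X, φ n X ≤ 1
  tendsto : ∀ X : ℕ → Site d, X 0 = 0 → ∀ k,
    Tendsto (fun n => φ n X - φ n (increments k X)) atTop (𝓝 0)

theorem measurable_testFun_scaledPath {d : ℕ} (v : Space d) (i : Finset (ℕ × ℕ) × ℕ) (n : ℕ) :
    Measurable fun X : ℕ → Site d => testFun i (scaledPath v n X).1 :=
  ((continuous_testFun i).comp (continuous_scaledPath v n)).measurable

theorem forgetful_testFun {d : ℕ} (v : Space d) (i : Finset (ℕ × ℕ) × ℕ) :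
    Forgetful fun n (X : ℕ → Site d) => testFun i (scaledPath v n X).1 :=
  ⟨measurable_testFun_scaledPath v i, fun _ _ => testFun_nonneg _ _,
    fun _ _ => testFun_le_one _ _, fun _ hX k => tendsto_testFun_increments i v hX k⟩

/-- The expectation of `φ n` over `A` converges to `w` times the probability of `A`. -/
def ConvOn {d : ℕ} (φ : ℕ → (ℕ → Site d) → ℝ) (w : ℝ≥0∞) (ω : Env d) (A : Set (ℕ → Site d)) :
    Prop :=
  Tendsto (fun n => ∫⁻ X in A, ENNReal.ofReal (φ n X) ∂pathLaw ω) atTop (𝓝 (w * pathLaw ω A))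

theorem Forgetful.setLIntegral_le {d : ℕ} {φ : ℕ → (ℕ → Site d) → ℝ} (hφ : Forgetful φ)
    (ω : Env d) (n : ℕ) (A : Set (ℕ → Site d)) :
    ∫⁻ X in A, ENNReal.ofReal (φ n X) ∂pathLaw ω ≤ pathLaw ω A := by
  refine (lintegral_mono fun X => ENNReal.ofReal_le_one.2 (hφ.le_one n X)).trans ?_
  simp

/-- Replacing `φ n X` by its value on the increments after `k` costs nothing in the limit. The
Markov property then turns the integral into an average over `X k` of integrals in the shifted
environments, which converge boundedly. -/
theorem ConvOn.of_increments {d : ℕ} {φ : ℕ → (ℕ → Site d) → ℝ} (hφ : Forgetful φ) {w : ℝ≥0∞}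
    (hw : w ≠ ∞) {ω : Env d} {k : ℕ} {C A : Set (ℕ → Site d)} (hC : MeasurableSet C)
    (hdep : ∀ X Y : ℕ → Site d, (∀ j ≤ k, X j = Y j) → X ∈ C → Y ∈ C) (hA : MeasurableSet A)
    (h : ∀ᵐ X ∂pathLaw ω, ConvOn φ w (shift (X k) ω) A) :
    ConvOn φ w ω (C ∩ increments k ⁻¹' A) := by
  have hpre := measurable_increments k hA
  have hset : ∀ F : (ℕ → Site d) → ℝ≥0∞, ∫⁻ X in C ∩ increments k ⁻¹' A, F X ∂pathLaw ω =
      ∫⁻ X in C, (increments k ⁻¹' A).indicator F X ∂pathLaw ω := fun F => by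
    rw [lintegral_indicator hpre, Measure.restrict_restrict hpre, Set.inter_comm]
  have hφm : ∀ n, Measurable fun X => ENNReal.ofReal (φ n X) := fun n =>
    (hφ.measurable n).ennreal_ofReal
  have hb : ∀ n, ∫⁻ X in C ∩ increments k ⁻¹' A, ENNReal.ofReal (φ n (increments k X)) ∂pathLaw ω =
      ∫⁻ X in C, ∫⁻ Y in A, ENNReal.ofReal (φ n Y) ∂pathLaw (shift (X k) ω) ∂pathLaw ω := fun n => by
    simp only [hset, ← lintegral_indicator hA]
    rw [← setLIntegral_increments k ω hC hdep ((hφm n).indicator hA)]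
    rfl
  have hp : pathLaw ω (C ∩ increments k ⁻¹' A) =
      ∫⁻ X in C, pathLaw (shift (X k) ω) A ∂pathLaw ω := by
    rw [← setLIntegral_one, hset]
    simp only [← lintegral_indicator_one hA]
    rw [← setLIntegral_increments k ω hC hdep (measurable_one.indicator hA)]
    rfl
  have hmeas : ∀ {G : (ℕ → Site d) → ℝ≥0∞}, Measurable G →
      Measurable fun X : ℕ → Site d => ∫⁻ Y in A, G Y ∂pathLaw (shift (X k) ω) := fun {G} hG => by
    simp only [← lintegral_indicator hA]
    exact measurable_lintegral_shift k ω (Φ := fun _ Y => A.indicator G Y)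
      ((hG.indicator hA).comp measurable_snd)
  have hblim : Tendsto (fun n => ∫⁻ X in C ∩ increments k ⁻¹' A,
      ENNReal.ofReal (φ n (increments k X)) ∂pathLaw ω) atTop
      (𝓝 (w * pathLaw ω (C ∩ increments k ⁻¹' A))) := by
    rw [hp, ← lintegral_const_mul' _ _ hw]
    simp only [hb]
    refine tendsto_lintegral_of_dominated_convergence (fun _ => 1) (fun n => hmeas (hφm n))
      (fun n => Eventually.of_forall fun X => (hφ.setLIntegral_le _ n A).trans prob_le_one)
      (by simp) (ae_restrict_of_ae h)
  have hclim : Tendsto (fun n => ∫⁻ X in C ∩ increments k ⁻¹' A,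
      ENNReal.ofReal |φ n X - φ n (increments k X)| ∂pathLaw ω) atTop (𝓝 0) := by
    have := tendsto_lintegral_of_dominated_convergence
      (μ := (pathLaw ω).restrict (C ∩ increments k ⁻¹' A))
      (F := fun n X => ENNReal.ofReal |φ n X - φ n (increments k X)|) (f := fun _ => 0)
      (fun _ => 1)
      (fun n => (((hφ.measurable n).sub
        ((hφ.measurable n).comp (measurable_increments k))).abs).ennreal_ofReal)
      (fun n => Eventually.of_forall fun X => ENNReal.ofReal_le_one.2 (abs_le.2
        ⟨by linarith [hφ.nonneg n X, hφ.le_one n (increments k X)],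
          by linarith [hφ.le_one n X, hφ.nonneg n (increments k X)]⟩))
      (by simp) (ae_restrict_of_ae <| by
        filter_upwards [ae_path_zero ω] with X hX
        have := (hφ.tendsto X hX k).abs
        rw [abs_zero] at this
        simpa using ENNReal.tendsto_ofReal this)
    simpa using this
  have hLne : w * pathLaw ω (C ∩ increments k ⁻¹' A) ≠ ∞ :=
    ENNReal.mul_ne_top hw (measure_ne_top _ _)
  -- The integral of `φ n X` lies between that of `φ n (increments k X)` minus and plus the
  -- vanishing error `hclim`.
  have hlow := ENNReal.Tendsto.sub hblim hclim (Or.inl hLne)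
  have hupp := hblim.add hclim
  rw [tsub_zero] at hlow
  rw [add_zero] at hupp
  have hcm : ∀ n, Measurable fun X => ENNReal.ofReal |φ n X - φ n (increments k X)| := fun n =>
    (((hφ.measurable n).sub ((hφ.measurable n).comp (measurable_increments k))).abs).ennreal_ofReal
  refine tendsto_of_tendsto_of_tendsto_of_le_of_le hlow hupp (fun n => ?_) (fun n => ?_)
  · simp only
    rw [tsub_le_iff_right, ← lintegral_add_right _ (hcm n)]
    refine lintegral_mono fun X => ?_
    rw [← ENNReal.ofReal_add (hφ.nonneg n X) (abs_nonneg _)]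
    refine ENNReal.ofReal_le_ofReal ?_
    have := neg_abs_le (φ n X - φ n (increments k X))
    linarith
  · simp only
    rw [← lintegral_add_right _ (hcm n)]
    refine lintegral_mono fun X => ?_
    rw [← ENNReal.ofReal_add (hφ.nonneg n _) (abs_nonneg _)]
    refine ENNReal.ofReal_le_ofReal ?_
    have := le_abs_self (φ n X - φ n (increments k X))
    linarith

theorem ConvOn.iUnion {d : ℕ} {φ : ℕ → (ℕ → Site d) → ℝ} (hφ : Forgetful φ) {w : ℝ≥0∞}
    {ω : Env d} {E : ℕ → Set (ℕ → Site d)} (hE : ∀ k, MeasurableSet (E k))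
    (hd : Pairwise (Function.onFun Disjoint E)) (h : ∀ k, ConvOn φ w ω (E k)) :
    ConvOn φ w ω (⋃ k, E k) := by
  unfold ConvOn
  simp only [lintegral_iUnion hE hd]
  rw [measure_iUnion hd hE, ← ENNReal.tsum_mul_left]
  -- The sum over `k` becomes an integral for counting measure, dominated by the summable
  -- probabilities of the `E k`.
  simp only [← lintegral_count]
  refine tendsto_lintegral_of_dominated_convergence (fun k => pathLaw ω (E k))
    (fun n => measurable_of_countable _)
    (fun n => Eventually.of_forall fun k => hφ.setLIntegral_le ω n (E k)) ?_
    (Eventually.of_forall h)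
  rw [lintegral_count, ← measure_iUnion hd hE]
  exact measure_ne_top _ _

theorem ConvOn.of_compl {d : ℕ} {φ : ℕ → (ℕ → Site d) → ℝ} (hφ : Forgetful φ) {w : ℝ≥0∞}
    (hw : w ≠ ∞) {ω : Env d} {A : Set (ℕ → Site d)} (hA : MeasurableSet A)
    (hu : ConvOn φ w ω Set.univ) (hc : ConvOn φ w ω Aᶜ) : ConvOn φ w ω A := by
  unfold ConvOn at *
  have hsub := ENNReal.Tendsto.sub hu hc
    (Or.inl (ENNReal.mul_ne_top hw (measure_ne_top _ _)))
  have hne : w * pathLaw ω Aᶜ ≠ ∞ := ENNReal.mul_ne_top hw (measure_ne_top _ _)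
  rw [← measure_add_measure_compl hA, mul_add, ENNReal.add_sub_cancel_right hne] at hsub
  refine hsub.congr fun n => ?_
  rw [setLIntegral_univ, ← lintegral_add_compl _ hA]
  exact ENNReal.add_sub_cancel_right
    (ne_top_of_le_ne_top (measure_ne_top _ _) (hφ.setLIntegral_le ω n Aᶜ))

/-! ### From convergence on all paths to half-space paths, and back -/

/-- The half space of the sites `x` with `ℓ ≤ x · u`. -/
def halfSpace {d : ℕ} (u : Site d) (ℓ : ℤ) : Set (Site d) := {x | ℓ ≤ x ⬝ᵥ u}

/-- The complement is the disjoint union of the exit events at time `k`. Each is decided by time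
`k`, and the walk afterwards starts in an environment that is still in `Γ`. -/
theorem ConvOn.stay {d : ℕ} {φ : ℕ → (ℕ → Site d) → ℝ} (hφ : Forgetful φ) {w : ℝ≥0∞}
    (hw : w ≠ ∞) {Γ : Set (Env d)} (hΓ : StepClosed Γ) (h : ∀ ω ∈ Γ, ConvOn φ w ω Set.univ)
    (H : Set (Site d)) {ω : Env d} (hω : ω ∈ Γ) : ConvOn φ w ω (stay H) := by
  refine ConvOn.of_compl hφ hw (measurableSet_stay H) (h ω hω) ?_
  let C : ℕ → Set (ℕ → Site d) := fun k => {X | (∀ j < k, X j ∈ H) ∧ X k ∉ H}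
  have hC : ∀ k, MeasurableSet (C k) := fun k => by
    have : C k = (⋂ j ∈ Set.Iio k, (fun X : ℕ → Site d => X j) ⁻¹' H) ∩
        (fun X : ℕ → Site d => X k) ⁻¹' Hᶜ := by
      ext X; simp [C]
    rw [this]
    exact (MeasurableSet.biInter (Set.to_countable _) fun j _ =>
      measurable_pi_apply j (Set.to_countable H).measurableSet).inter
      (measurable_pi_apply k (Set.to_countable _).measurableSet)
  have hU : (RWRE.stay H)ᶜ = ⋃ k, C k := by
    classical
    ext X
    simp only [RWRE.stay, C, Set.mem_compl_iff, Set.mem_ofPred_eq, Set.mem_iUnion, not_forall]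
    constructor
    · intro hX
      exact ⟨Nat.find hX, fun j hj => not_not.1 (Nat.find_min hX hj), Nat.find_spec hX⟩
    · rintro ⟨k, -, hk⟩
      exact ⟨k, hk⟩
  rw [hU]
  refine ConvOn.iUnion hφ hC (fun k k' hkk => Set.disjoint_left.2 fun X hX hX' => ?_) fun k => ?_
  · rcases lt_or_gt_of_ne hkk with hlt | hlt
    · exact hX.2 (hX'.1 k hlt)
    · exact hX'.2 (hX.1 k' hlt)
  · have := ConvOn.of_increments hφ hw (ω := ω) (k := k) (A := Set.univ) (hC k)
      (fun X Y hXY hX => ⟨fun j hj => hXY j hj.le ▸ hX.1 j hj, hXY k le_rfl ▸ hX.2⟩)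
      MeasurableSet.univ (by
        filter_upwards [hΓ.ae_path hω] with X hX
        exact h _ (hX k))
    simpa using this

theorem ConvOn.univ_of_stay {d : ℕ} {φ : ℕ → (ℕ → Site d) → ℝ} (hφ : Forgetful φ) {w : ℝ≥0∞}
    (hw : w ≠ ∞) {u : Site d} {ω : Env d}
    (h : ∀ z, ConvOn φ w (shift z ω) (RWRE.stay (halfSpace u 0)))
    (htr : ∀ᵐ X ∂pathLaw ω, Tendsto (fun n => X n ⬝ᵥ u) atTop atTop) :
    ConvOn φ w ω Set.univ := by
  -- `C k` says that the level at time `k` is strictly below all earlier ones; with increments that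
  -- stay nonnegative afterwards, `E k` says that `k` is the first time of the global minimum. These
  -- events are disjoint, and transience makes them exhaustive.
  let C : ℕ → Set (ℕ → Site d) := fun k => {X | ∀ j < k, X k ⬝ᵥ u < X j ⬝ᵥ u}
  have hC : ∀ k, MeasurableSet (C k) := fun k => by
    have : C k = ⋂ j ∈ Set.Iio k,
        (fun X : ℕ → Site d => (X k, X j)) ⁻¹' {p | p.1 ⬝ᵥ u < p.2 ⬝ᵥ u} := by
      ext X; simp [C]
    rw [this]
    exact MeasurableSet.biInter (Set.to_countable _) fun j _ =>
      ((measurable_pi_apply k).prodMk (measurable_pi_apply j)) (Set.to_countable _).measurableSet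
  let E : ℕ → Set (ℕ → Site d) := fun k => C k ∩ increments k ⁻¹' RWRE.stay (halfSpace u 0)
  have hmem : ∀ k X, X ∈ E k → ∀ j, k ≤ j → X k ⬝ᵥ u ≤ X j ⬝ᵥ u := by
    rintro k X ⟨-, hX⟩ j hj
    have := hX (j - k)
    simp only [increments, halfSpace, Set.mem_ofPred_eq, sub_dotProduct,
      Nat.add_sub_cancel' hj] at this
    omega
  have hE : ConvOn φ w ω (⋃ k, E k) := by
    refine ConvOn.iUnion hφ
      (fun k => (hC k).inter (measurable_increments k (measurableSet_stay _)))
      (fun k k' hkk => Set.disjoint_left.2 fun X hX hX' => ?_) fun k => ?_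
    · rcases lt_or_gt_of_ne hkk with hlt | hlt
      · exact absurd (hX'.1 k hlt) (not_lt.2 (hmem k X hX k' hlt.le))
      · exact absurd (hX.1 k' hlt) (not_lt.2 (hmem k' X hX' k hlt.le))
    · exact ConvOn.of_increments hφ hw (hC k)
        (fun X Y hXY hX j hj => hXY k le_rfl ▸ hXY j hj.le ▸ hX j hj) (measurableSet_stay _)
        (Eventually.of_forall fun X => h _)
  have hae : (⋃ k, E k : Set (ℕ → Site d)) =ᵐ[pathLaw ω] Set.univ := by
    rw [ae_eq_univ]
    refine mem_ae_iff.1 ?_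
    filter_upwards [htr] with X hX
    classical
    obtain ⟨k₀, hk₀⟩ : ∃ k, ∀ j, X k ⬝ᵥ u ≤ X j ⬝ᵥ u := by
      rw [← Nat.cofinite_eq_atTop] at hX
      exact hX.exists_forall_le
    have hex : ∃ k, ∀ j, X k ⬝ᵥ u ≤ X j ⬝ᵥ u := ⟨k₀, hk₀⟩
    refine Set.mem_iUnion.2 ⟨Nat.find hex, fun j hj => ?_, fun j => ?_⟩
    · have h1 := Nat.find_min hex hj
      push Not at h1
      obtain ⟨m, hm⟩ := h1
      exact (Nat.find_spec hex m).trans_lt hm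
    · have := Nat.find_spec hex (Nat.find hex + j)
      simp only [increments, halfSpace, Set.mem_ofPred_eq, sub_dotProduct]
      omega
  unfold ConvOn at *
  rw [← measure_congr hae]
  exact hE.congr fun n => setLIntegral_congr hae

/-! ### Functions of the environment in a set of sites -/

/-- The `σ`-algebra generated by the environment in `H`. -/
@[reducible] def localSigma {d : ℕ} (H : Set (Site d)) : MeasurableSpace (Env d) :=
  ⨆ x ∈ H, MeasurableSpace.comap (fun ω : Env d => ω x) inferInstance

theorem localSigma_le {d : ℕ} (H : Set (Site d)) : localSigma H ≤ MeasurableSpace.pi :=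
  iSup₂_le fun x _ => (measurable_pi_apply x).comap_le

theorem comap_le_localSigma {d : ℕ} {H : Set (Site d)} {x : Site d} (hx : x ∈ H) :
    MeasurableSpace.comap (fun ω : Env d => ω x) inferInstance ≤ localSigma H :=
  le_iSup₂ (f := fun x (_ : x ∈ H) =>
    MeasurableSpace.comap (fun ω : Env d => ω x) inferInstance) x hx

theorem localSigma_mono {d : ℕ} {H H' : Set (Site d)} (h : H ⊆ H') :
    localSigma H ≤ localSigma H' :=
  biSup_mono h

theorem localSigma_halfSpace_le {d : ℕ} (u : Site d) (ℓ : ℤ) :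
    localSigma (halfSpace u ℓ) ≤ futureSigma u ℓ :=
  iSup₂_le fun x hx => le_iSup (fun x : {x : Site d // ℓ ≤ x ⬝ᵥ u} =>
    MeasurableSpace.comap (fun ω : Env d => ω x.1) inferInstance) ⟨x, hx⟩

/-- Overwriting the environment off `H` by a fixed step law is measurable for `localSigma H` and
does not change `f`. -/
theorem measurable_of_local {d : ℕ} {β : Type*} [MeasurableSpace β] {H : Set (Site d)}
    {f : Env d → β} (hf : Measurable f)
    (hloc : ∀ ω ω' : Env d, (∀ x ∈ H, ω x = ω' x) → f ω = f ω') :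
    Measurable[localSigma H] f := by
  classical
  let θ : Env d → Env d := fun ω x => if x ∈ H then ω x else PMF.pure 0
  have hθ : Measurable[localSigma H] θ := by
    refine @measurable_pi_lambda _ _ _ (localSigma H) _ _ fun x => ?_
    by_cases hx : x ∈ H
    · simp only [θ, hx, if_true]
      exact measurable_iff_comap_le.2 (comap_le_localSigma hx)
    · simp only [θ, hx, if_false]
      exact measurable_const
  have : f = f ∘ θ := by
    funext ω
    exact hloc _ _ fun x hx => by simp [θ, hx]
  rw [this]
  exact hf.comp hθ

theorem measurableSet_of_local {d : ℕ} {H : Set (Site d)} {A : Set (Env d)}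
    (hA : MeasurableSet A)
    (hloc : ∀ ω ω' : Env d, (∀ x ∈ H, ω x = ω' x) → (ω ∈ A ↔ ω' ∈ A)) :
    MeasurableSet[localSigma H] A := by
  have h : Measurable[localSigma H] fun ω : Env d => ω ∈ A :=
    measurable_of_local (measurable_mem.2 hA) fun ω ω' h => propext (hloc ω ω' h)
  have h' := h (MeasurableSet.singleton True)
  have hA' : (fun ω : Env d => ω ∈ A) ⁻¹' {True} = A := by ext; simp
  rwa [hA'] at h'

theorem IsIIDProduct.indep {d : ℕ} {P : Measure (Env d)} (hP : IsIIDProduct P)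
    {H H' : Set (Site d)} (h : Disjoint H H') : Indep (localSigma H) (localSigma H') P := by
  obtain ⟨μ, hμ, rfl⟩ := hP
  have hind : iIndepFun (fun (x : Site d) (ω : Env d) => ω x)
      (Measure.infinitePi fun _ : Site d => μ) :=
    iIndepFun_infinitePi (X := fun _ p => p) fun _ => measurable_id
  exact indep_iSup_of_disjoint (fun x => (measurable_pi_apply x).comap_le) hind h

/-! ### An event seen by the walk -/

/-- The paths along which the environment seen from the walk is always in `G`. -/
def seen {d : ℕ} (G : Set (Env d)) (ω : Env d) : Set (ℕ → Site d) := {X | ∀ k, shift (X k) ω ∈ G}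

theorem measurableSet_shift_mem {d : ℕ} {G : Set (Env d)} (hG : MeasurableSet G) :
    MeasurableSet {p : Env d × Site d | shift p.2 p.1 ∈ G} := by
  have : {p : Env d × Site d | shift p.2 p.1 ∈ G} =
      ⋃ z : Site d, (shift z ⁻¹' G) ×ˢ {z} := by
    ext ⟨ω, z⟩
    simp
  rw [this]
  exact MeasurableSet.iUnion fun z => (measurable_shift z hG).prod (MeasurableSet.singleton z)

theorem measurableSet_seen_prod {d : ℕ} {G : Set (Env d)} (hG : MeasurableSet G) :
    MeasurableSet {p : Env d × (ℕ → Site d) | p.2 ∈ seen G p.1} := by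
  have : {p : Env d × (ℕ → Site d) | p.2 ∈ seen G p.1} =
      ⋂ k, (fun p : Env d × (ℕ → Site d) => (p.1, p.2 k)) ⁻¹'
        {p : Env d × Site d | shift p.2 p.1 ∈ G} := by
    ext p; simp [seen]
  rw [this]
  exact MeasurableSet.iInter fun k =>
    (measurable_fst.prodMk ((measurable_pi_apply k).comp measurable_snd))
      (measurableSet_shift_mem hG)

theorem measurableSet_seen {d : ℕ} {G : Set (Env d)} (hG : MeasurableSet G) (ω : Env d) :
    MeasurableSet (seen G ω) :=
  measurable_prodMk_left (x := ω) (measurableSet_seen_prod hG)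

theorem measurable_pathLaw_section {d : ℕ} {S : Set (Env d × (ℕ → Site d))}
    (hS : MeasurableSet S) : Measurable fun ω => pathLaw ω (Prod.mk ω ⁻¹' S) :=
  Kernel.measurable_kernel_prodMk_left (κ := pathKernel d) hS

theorem measurable_pathLaw {d : ℕ} {A : Set (ℕ → Site d)} (hA : MeasurableSet A) :
    Measurable fun ω : Env d => pathLaw ω A :=
  (pathKernel d).measurable_coe hA

theorem measurable_pathLaw_seen {d : ℕ} {G : Set (Env d)} (hG : MeasurableSet G) :
    Measurable fun ω => pathLaw ω (seen G ω) := by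
  have h := measurable_pathLaw_section (measurableSet_seen_prod hG)
  exact h

/-! ### First entry above a level and the fresh environment -/

/-- Paths that are at `z` at time `n` and below level `L` before. -/
def firstEntry {d : ℕ} (u : Site d) (L : ℤ) (p : ℕ × Site d) : Set (ℕ → Site d) :=
  {X | (∀ j < p.1, X j ⬝ᵥ u < L) ∧ X p.1 = p.2}

theorem measurableSet_firstEntry {d : ℕ} (u : Site d) (L : ℤ) (p : ℕ × Site d) :
    MeasurableSet (firstEntry u L p) := by
  have : firstEntry u L p = (⋂ j ∈ Set.Iio p.1, (fun X : ℕ → Site d => X j) ⁻¹'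
      {x | x ⬝ᵥ u < L}) ∩ (fun X : ℕ → Site d => X p.1) ⁻¹' {p.2} := by
    ext X; simp [firstEntry]
  rw [this]
  exact (MeasurableSet.biInter (Set.to_countable _) fun j _ =>
    measurable_pi_apply j (Set.to_countable _).measurableSet).inter
    (measurable_pi_apply p.1 (MeasurableSet.singleton _))

theorem pathLaw_seen_le_tsum {d : ℕ} {u : Site d} {ω : Env d} (G : Set (Env d)) (L : ℤ)
    (htr : ∀ᵐ X ∂pathLaw ω, Tendsto (fun n => X n ⬝ᵥ u) atTop atTop) :
    pathLaw ω (seen G ω) ≤ ∑' p : {p : ℕ × Site d // L ≤ p.2 ⬝ᵥ u},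
      pathLaw ω (firstEntry u L p.1) * (shift p.1.2 ⁻¹' G).indicator 1 ω := by
  have hsub : seen G ω ≤ᵐ[pathLaw ω] (⋃ p : {p : ℕ × Site d // L ≤ p.2 ⬝ᵥ u},
      {X | X ∈ firstEntry u L p.1 ∧ shift p.1.2 ω ∈ G} : Set (ℕ → Site d)) := by
    filter_upwards [htr] with X hX hseen
    classical
    have hex : ∃ n, L ≤ X n ⬝ᵥ u := (hX.eventually_ge_atTop L).exists
    refine Set.mem_iUnion.2 ⟨⟨(Nat.find hex, X (Nat.find hex)), Nat.find_spec hex⟩,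
      ⟨fun j hj => not_le.1 (Nat.find_min hex hj), rfl⟩, hseen _⟩
  refine (measure_mono_ae hsub).trans ((measure_iUnion_le _).trans
    (ENNReal.tsum_le_tsum fun p => ?_))
  by_cases hp : shift p.1.2 ω ∈ G
  · simp [hp]
  · simp [hp]

theorem tsum_firstEntry_le {d : ℕ} (u : Site d) (L : ℤ) (ω : Env d) :
    ∑' p : {p : ℕ × Site d // L ≤ p.2 ⬝ᵥ u}, pathLaw ω (firstEntry u L p.1) ≤ 1 := by
  have hd : Pairwise (Function.onFun Disjoint
      fun p : {p : ℕ × Site d // L ≤ p.2 ⬝ᵥ u} => firstEntry u L p.1) := by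
    rintro ⟨⟨n, z⟩, hz⟩ ⟨⟨n', z'⟩, hz'⟩ hne
    refine Set.disjoint_left.2 fun X hX hX' => hne ?_
    simp only [firstEntry, Set.mem_ofPred_eq] at hX hX' hz hz'
    have hn : n = n' := by
      rcases lt_trichotomy n n' with h | h | h
      · have := hX'.1 n h
        rw [hX.2] at this
        omega
      · exact h
      · have := hX.1 n' h
        rw [hX'.2] at this
        omega
    subst hn
    obtain rfl : z = z' := hX.2.symm.trans hX'.2
    rfl
  rw [← measure_iUnion hd fun p => measurableSet_firstEntry u L p.1]
  exact prob_le_one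

/-- All steps before the entry start strictly below `L`, so the entry law uses only that part of the
environment and is independent of what the walk finds at the entry site. -/
theorem firstEntry_congr {d : ℕ} (u : Site d) (L : ℤ) (p : ℕ × Site d) {ω ω' : Env d}
    (h : ∀ x ∈ (halfSpace u L)ᶜ, ω x = ω' x) :
    pathLaw ω (firstEntry u L p) = pathLaw ω' (firstEntry u L p) :=
  pathLaw_congr p.1 _ h (measurableSet_firstEntry u L p)
    (fun _ _ hXY hX => ⟨fun j hj => hXY j hj.le ▸ hX.1 j hj, hXY p.1 le_rfl ▸ hX.2⟩)
    fun _ hX j hj => not_le.2 (hX.1 j hj)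

/-- The set `G` of environments depends on the sites `x` with `0 ≤ x · u` only. -/
def FutureSet {d : ℕ} (u : Site d) (G : Set (Env d)) : Prop :=
  ∀ ω ω' : Env d, (∀ x ∈ halfSpace u 0, ω x = ω' x) → (ω ∈ G ↔ ω' ∈ G)

theorem FutureSet.shift_mem_iff {d : ℕ} {u : Site d} {G : Set (Env d)} (hG : FutureSet u G)
    {L : ℤ} {z : Site d} (hz : L ≤ z ⬝ᵥ u) {ω ω' : Env d}
    (h : ∀ x ∈ halfSpace u L, ω x = ω' x) : shift z ω ∈ G ↔ shift z ω' ∈ G := by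
  refine hG _ _ fun x hx => h (x + z) ?_
  simp only [halfSpace, Set.mem_ofPred_eq, add_dotProduct] at hx ⊢
  omega

/-- Given the environment below a level, the walk sees a fresh environment when it first
reaches that level. -/
theorem IsIIDProduct.setLIntegral_seen_le {d : ℕ} {u : Site d} {P : Measure (Env d)}
    (hP : IsIIDProduct P)
    (htr : ∀ᵐ ω ∂P, ∀ᵐ X ∂pathLaw ω, Tendsto (fun n => X n ⬝ᵥ u) atTop atTop)
    {G : Set (Env d)} (hGm : MeasurableSet G) (hG : FutureSet u G) (L : ℤ) {A : Set (Env d)}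
    (hA : MeasurableSet[localSigma (halfSpace u L)ᶜ] A) :
    ∫⁻ ω in A, pathLaw ω (seen G ω) ∂P ≤ P G * P A := by
  have hA' : MeasurableSet A := localSigma_le _ _ hA
  have hterm : ∀ p : {p : ℕ × Site d // L ≤ p.2 ⬝ᵥ u},
      ∫⁻ ω in A, pathLaw ω (firstEntry u L p.1) * (shift p.1.2 ⁻¹' G).indicator 1 ω ∂P =
        P G * ∫⁻ ω in A, pathLaw ω (firstEntry u L p.1) ∂P := fun p => by
    have hm := measurable_pathLaw (measurableSet_firstEntry u L p.1)
    have hm1 : Measurable[localSigma (halfSpace u L)ᶜ]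
        (A.indicator fun ω => pathLaw ω (firstEntry u L p.1)) :=
      (measurable_of_local hm fun ω ω' h => firstEntry_congr u L p.1 h).indicator hA
    have hpre : MeasurableSet (shift p.1.2 ⁻¹' G) := measurable_shift p.1.2 hGm
    have hm2 : Measurable[localSigma (halfSpace u L)]
        ((shift p.1.2 ⁻¹' G).indicator (1 : Env d → ℝ≥0∞)) :=
      measurable_of_local (measurable_one.indicator hpre) fun ω ω' h => by
        have : ω ∈ shift p.1.2 ⁻¹' G ↔ ω' ∈ shift p.1.2 ⁻¹' G := hG.shift_mem_iff p.2 h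
        by_cases hω : ω ∈ shift p.1.2 ⁻¹' G
        · rw [Set.indicator_of_mem hω, Set.indicator_of_mem (this.1 hω)]
          rfl
        · rw [Set.indicator_of_notMem hω, Set.indicator_of_notMem fun h' => hω (this.2 h')]
    have hind := lintegral_mul_eq_lintegral_mul_lintegral_of_independent_measurableSpace
      (localSigma_le _) (localSigma_le _) (hP.indep disjoint_compl_left) hm1 hm2
    rw [lintegral_indicator_one hpre, ← Measure.map_apply (measurable_shift p.1.2) hGm,
      hP.map_shift, lintegral_indicator hA', mul_comm] at hind
    rw [← hind, ← lintegral_indicator hA']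
    refine lintegral_congr fun ω => ?_
    by_cases hω : ω ∈ A <;> simp [hω]
  have hfe : ∀ p : {p : ℕ × Site d // L ≤ p.2 ⬝ᵥ u},
      Measurable fun ω : Env d => pathLaw ω (firstEntry u L p.1) := fun p =>
    measurable_pathLaw (measurableSet_firstEntry u L p.1)
  have hmul : ∀ p : {p : ℕ × Site d // L ≤ p.2 ⬝ᵥ u}, Measurable fun ω : Env d =>
      pathLaw ω (firstEntry u L p.1) * (shift p.1.2 ⁻¹' G).indicator (1 : Env d → ℝ≥0∞) ω :=
    fun p => (hfe p).mul (measurable_one.indicator (measurable_shift p.1.2 hGm))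
  calc ∫⁻ ω in A, pathLaw ω (seen G ω) ∂P
      ≤ ∫⁻ ω in A, ∑' p : {p : ℕ × Site d // L ≤ p.2 ⬝ᵥ u},
          pathLaw ω (firstEntry u L p.1) * (shift p.1.2 ⁻¹' G).indicator 1 ω ∂P := by
        refine lintegral_mono_ae (ae_restrict_of_ae ?_)
        filter_upwards [htr] with ω hω
        exact pathLaw_seen_le_tsum G L hω
    _ = ∑' p : {p : ℕ × Site d // L ≤ p.2 ⬝ᵥ u}, P G * ∫⁻ ω in A,
          pathLaw ω (firstEntry u L p.1) ∂P := by
        rw [lintegral_tsum fun p => (hmul p).aemeasurable]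
        exact tsum_congr hterm
    _ = P G * ∫⁻ ω in A, ∑' p : {p : ℕ × Site d // L ≤ p.2 ⬝ᵥ u},
          pathLaw ω (firstEntry u L p.1) ∂P := by
        rw [ENNReal.tsum_mul_left, lintegral_tsum fun p => (hfe p).aemeasurable]
    _ ≤ P G * ∫⁻ ω in A, 1 ∂P := by
        gcongr with ω
        exact tsum_firstEntry_le u L ω
    _ = P G * P A := by rw [setLIntegral_one]

theorem iSup_localSigma {d : ℕ} (u : Site d) :
    ⨆ n : ℕ, localSigma (halfSpace u n)ᶜ = (MeasurableSpace.pi : MeasurableSpace (Env d)) := by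
  refine le_antisymm (iSup_le fun n => localSigma_le _) (iSup_le fun x => ?_)
  obtain ⟨n, hn⟩ : ∃ n : ℕ, x ∈ (halfSpace u n)ᶜ := by
    obtain ⟨n, hn⟩ := exists_nat_gt (x ⬝ᵥ u)
    exact ⟨n, not_le.2 hn⟩
  exact (comap_le_localSigma hn).trans (le_iSup (fun n : ℕ => localSigma (halfSpace u n)ᶜ) n)

/-- The filtration of the environments below the levels `0, 1, 2, …`. -/
def levelFiltration {d : ℕ} (u : Site d) :
    Filtration ℕ (MeasurableSpace.pi : MeasurableSpace (Env d)) where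
  seq n := localSigma (halfSpace u n)ᶜ
  mono' _ m hnm := localSigma_mono <| Set.compl_subset_compl.2 fun x (hx : (m : ℤ) ≤ x ⬝ᵥ u) =>
    (Int.ofNat_le.2 hnm).trans hx
  le' _ := localSigma_le _

theorem IsIIDProduct.ae_pathLaw_seen_le {d : ℕ} {u : Site d} {P : Measure (Env d)}
    (hP : IsIIDProduct P)
    (htr : ∀ᵐ ω ∂P, ∀ᵐ X ∂pathLaw ω, Tendsto (fun n => X n ⬝ᵥ u) atTop atTop)
    {G : Set (Env d)} (hGm : MeasurableSet G) (hG : FutureSet u G) :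
    ∀ᵐ ω ∂P, pathLaw ω (seen G ω) ≤ P G := by
  have := hP.isProbabilityMeasure
  set f : Env d → ℝ := fun ω => (pathLaw ω (seen G ω)).toReal with hf
  have hfm : Measurable f := (measurable_pathLaw_seen hGm).ennreal_toReal
  have hfi : Integrable f P := Integrable.of_bound hfm.aestronglyMeasurable 1
    (Eventually.of_forall fun ω => by
      rw [Real.norm_eq_abs, abs_of_nonneg ENNReal.toReal_nonneg]
      exact ENNReal.toReal_le_of_le_ofReal zero_le_one (by simpa using prob_le_one))
  have hset : ∀ (n : ℕ) (A : Set (Env d)), MeasurableSet[levelFiltration u n] A →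
      ∫ ω in A, f ω ∂P ≤ (P G).toReal * (P A).toReal := fun n A hA => by
    rw [hf, integral_toReal (measurable_pathLaw_seen hGm).aemeasurable
      (Eventually.of_forall fun ω => measure_lt_top _ _), ← ENNReal.toReal_mul]
    exact ENNReal.toReal_mono (ENNReal.mul_ne_top (measure_ne_top _ _) (measure_ne_top _ _))
      (hP.setLIntegral_seen_le htr hGm hG n hA)
  -- The bound over events below level `n` is a bound on the conditional expectation. As `n` grows
  -- these events generate the full `σ`-algebra, so the conditional expectations converge to `f`
  -- itself.
  have hcond : ∀ n, ∀ᵐ ω ∂P, (P[f | levelFiltration u n]) ω ≤ (P G).toReal := fun n => by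
    have hm := (levelFiltration u).le n
    refine ae_le_of_ae_le_trim (hm := hm) (ae_le_of_forall_setIntegral_le
      (integrable_condExp.trim hm stronglyMeasurable_condExp) (integrable_const _)
      fun A hA _ => ?_)
    rw [← setIntegral_trim hm stronglyMeasurable_condExp hA, setIntegral_condExp hm hfi hA]
    refine (hset n A hA).trans (le_of_eq ?_)
    rw [setIntegral_const, smul_eq_mul, mul_comm, Measure.real, trim_measurableSet_eq hm hA]
  have hlim := MeasureTheory.tendsto_ae_condExp (μ := P) (ℱ := levelFiltration u) f
  have hsup : ⨆ n, (levelFiltration u n : MeasurableSpace (Env d)) = MeasurableSpace.pi :=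
    iSup_localSigma u
  rw [hsup, condExp_of_stronglyMeasurable le_rfl hfm.stronglyMeasurable hfi] at hlim
  filter_upwards [hlim, ae_all_iff.2 hcond] with ω h1 h2
  exact (ENNReal.toReal_le_toReal (measure_ne_top _ _) (measure_ne_top _ _)).1
    (le_of_tendsto' h1 h2)

/-- If `G` does not have full measure then the walk in almost every environment sees the
complement of `G`. -/
theorem IsIIDProduct.ae_pathLaw_seen_eq_zero {d : ℕ} {u : Site d} {P : Measure (Env d)}
    (hP : IsIIDProduct P)
    (htr : ∀ᵐ ω ∂P, ∀ᵐ X ∂pathLaw ω, Tendsto (fun n => X n ⬝ᵥ u) atTop atTop)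
    {G : Set (Env d)} (hGm : MeasurableSet G) (hG : FutureSet u G) (hlt : P G < 1) :
    ∀ᵐ ω ∂P, pathLaw ω (seen G ω) = 0 := by
  filter_upwards [hP.ae_shift (hP.ae_pathLaw_seen_le htr hGm hG)] with ω hω
  let C : ℕ → Set (ℕ → Site d) := fun k => {X | ∀ j ≤ k, shift (X j) ω ∈ G}
  have hC : ∀ k, MeasurableSet (C k) := fun k => by
    have : C k = ⋂ j ∈ Set.Iic k, (fun X : ℕ → Site d => X j) ⁻¹' {x | shift x ω ∈ G} := by
      ext X; simp [C]
    rw [this]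
    exact MeasurableSet.biInter (Set.to_countable _) fun j _ =>
      measurable_pi_apply j (Set.to_countable _).measurableSet
  have hanti : Antitone C := fun k k' h X hX j hj => hX j (hj.trans h)
  have hI : seen G ω = ⋂ k, C k := by
    ext X
    simp only [seen, C, Set.mem_ofPred_eq, Set.mem_iInter]
    exact ⟨fun h k j _ => h j, fun h k => h k k le_rfl⟩
  have hlim : Tendsto (fun k => pathLaw ω (C k)) atTop (𝓝 (pathLaw ω (seen G ω))) := by
    rw [hI]
    exact tendsto_measure_iInter_atTop (fun k => (hC k).nullMeasurableSet) hanti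
      ⟨0, measure_ne_top _ _⟩
  -- To see only `G` forever, the walk must do so up to time `k` and then again from `X k`, where
  -- the quenched bound `P G` applies in the shifted environment.
  have hle : ∀ k, pathLaw ω (seen G ω) ≤ P G * pathLaw ω (C k) := fun k => by
    have hs := measurableSet_seen hGm ω
    rw [← lintegral_indicator_one hs, lintegral_markov k ω (measurable_one.indicator hs),
      ← lintegral_indicator_one (hC k), ← lintegral_const_mul _ (measurable_one.indicator (hC k))]
    refine lintegral_mono fun X => ?_
    by_cases hX : X ∈ C k
    · rw [Set.indicator_of_mem hX, Pi.one_apply, mul_one]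
      refine le_trans ?_ (hω (X k))
      rw [← lintegral_indicator_one (measurableSet_seen hGm _)]
      refine lintegral_mono_ae ?_
      filter_upwards [ae_path_zero (shift (X k) ω)] with Y hY
      by_cases hXY : splice k X Y ∈ seen G ω
      swap
      · rw [Set.indicator_of_notMem hXY]
        exact zero_le
      rw [Set.indicator_of_mem hXY, Set.indicator_of_mem (show Y ∈ seen G _ from ?_)]
      · rfl
      intro j
      have := hXY (k + j)
      rw [shift_shift]
      cases j with
      | zero => simpa [splice, hY] using this
      | succ j => simpa [splice] using this
    · have : ∀ Y, splice k X Y ∉ seen G ω := fun Y hY => hX fun j hj => by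
        simpa [splice, hj] using hY j
      simp [this]
  -- Letting `k` grow gives `p ≤ P G * p` for `p = pathLaw ω (seen G ω)`, which forces `p = 0`
  -- because `P G < 1`.
  have hfin := ge_of_tendsto' (ENNReal.Tendsto.const_mul hlim
    (Or.inr (ne_top_of_lt hlt))) hle
  by_contra hne
  have : P G * pathLaw ω (seen G ω) < 1 * pathLaw ω (seen G ω) :=
    ENNReal.mul_lt_mul_left hne (measure_ne_top _ _) hlt
  rw [one_mul] at this
  exact absurd hfin (not_le.2 this)

/-! ### Transfer of half-space events from equilibrium to the product measure -/

/-- Some walker stays above level `ℓ` and sees only environments in `G` with positive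
probability. -/
def trapped {d : ℕ} (u : Site d) (ℓ : ℤ) (G : Set (Env d)) : Set (Env d) :=
  {ω | ∃ z, pathLaw (shift z ω)
    (stay {x | z + x ∈ halfSpace u ℓ} ∩ seen G (shift z ω)) ≠ 0}

theorem measurableSet_trapped {d : ℕ} (u : Site d) (ℓ : ℤ) {G : Set (Env d)}
    (hGm : MeasurableSet G) : MeasurableSet (trapped u ℓ G) := by
  have hm : ∀ z, Measurable fun ω : Env d => pathLaw ω
      (stay {x | z + x ∈ halfSpace u ℓ} ∩ seen G ω) := fun z =>
    measurable_pathLaw_section (S := {p | p.2 ∈ stay {x | z + x ∈ halfSpace u ℓ}} ∩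
      {p | p.2 ∈ seen G p.1})
      ((measurable_snd (measurableSet_stay _)).inter (measurableSet_seen_prod hGm))
  have : trapped u ℓ G = ⋃ z, shift z ⁻¹' ((fun ω : Env d => pathLaw ω
      (stay {x | z + x ∈ halfSpace u ℓ} ∩ seen G ω)) ⁻¹' {0}ᶜ) := by
    ext ω; simp [trapped]
  rw [this]
  exact MeasurableSet.iUnion fun z =>
    measurable_shift z (hm z (MeasurableSet.singleton 0).compl)

/-- A walk that stays above `ℓ` reads the environment only there, and so does membership in `G` of
the environment seen from any such site. -/
theorem trapped_local {d : ℕ} (u : Site d) (ℓ : ℤ) {G : Set (Env d)} (hGm : MeasurableSet G)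
    (hG : FutureSet u G) {ω ω' : Env d} (h : ∀ x ∈ halfSpace u ℓ, ω x = ω' x) :
    ω ∈ trapped u ℓ G ↔ ω' ∈ trapped u ℓ G := by
  refine exists_congr fun z => not_congr ?_
  set H : Set (Site d) := {x | z + x ∈ halfSpace u ℓ}
  have hH : ∀ x ∈ H, shift z ω x = shift z ω' x := fun x hx => by
    have := h (z + x) hx
    simpa [shift, add_comm] using this
  have hsets : stay H ∩ seen G (shift z ω) = stay H ∩ seen G (shift z ω') := by
    ext X
    refine and_congr_right fun hX => forall_congr' fun k => ?_
    rw [shift_shift, shift_shift]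
    exact hG.shift_mem_iff (hX k) h
  have hm := measurableSet_seen hGm (shift z ω')
  rw [hsets, Set.inter_comm, ← Measure.restrict_apply hm, ← Measure.restrict_apply hm,
    restrict_stay_congr H hH]

/-- By transience the walk is above `ℓ` from some time `m` on with positive probability. The
position `X m` of a suitable path is the starting site required by `trapped`, and step-closedness
keeps the environment seen from there in `Γ ⊆ G`. -/
theorem mem_trapped {d : ℕ} {u : Site d} (ℓ : ℤ) {G Γ : Set (Env d)} (hΓ : StepClosed Γ)
    (hΓG : Γ ⊆ G) {ω : Env d} (hω : ω ∈ Γ)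
    (htr : ∀ᵐ X ∂pathLaw ω, Tendsto (fun n => X n ⬝ᵥ u) atTop atTop) : ω ∈ trapped u ℓ G := by
  let D : ℕ → Set (ℕ → Site d) := fun m => {X | ∀ k, m ≤ k → X k ∈ halfSpace u ℓ}
  have hD : ∀ m, MeasurableSet (D m) := fun m => by
    have : D m = ⋂ k ∈ Set.Ici m, (fun X : ℕ → Site d => X k) ⁻¹' halfSpace u ℓ := by
      ext X; simp [D]
    rw [this]
    exact MeasurableSet.biInter (Set.to_countable _) fun j _ =>
      measurable_pi_apply j (Set.to_countable _).measurableSet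
  obtain ⟨m, hm⟩ : ∃ m, pathLaw ω (D m) ≠ 0 := by
    by_contra! hcon
    have h0 : pathLaw ω (⋃ m, D m) = 0 := measure_iUnion_null hcon
    have h1 : ∀ᵐ X ∂pathLaw ω, X ∈ ⋃ m, D m := by
      filter_upwards [htr] with X hX
      obtain ⟨m, hm⟩ := eventually_atTop.1 (hX.eventually_ge_atTop ℓ)
      exact Set.mem_iUnion.2 ⟨m, hm⟩
    have h2 : ∀ᵐ X ∂pathLaw ω, False := by
      filter_upwards [h1, measure_eq_zero_iff_ae_notMem.1 h0] with X hX hX'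
      exact hX' hX
    have h3 := ae_iff.1 h2
    simp at h3
  rw [← lintegral_indicator_one (hD m), lintegral_markov m ω (measurable_one.indicator (hD m))] at hm
  obtain ⟨X, hXΓ, hX⟩ : ∃ X : ℕ → Site d, shift (X m) ω ∈ Γ ∧
      ∫⁻ Y, (D m).indicator 1 (splice m X Y) ∂pathLaw (shift (X m) ω) ≠ 0 := by
    by_contra! hcon
    refine hm (lintegral_eq_zero_of_ae_eq_zero ?_)
    filter_upwards [hΓ.ae_path hω] with X hX
    exact hcon X (hX m)
  refine ⟨X m, fun h0 => hX (lintegral_eq_zero_of_ae_eq_zero ?_)⟩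
  filter_upwards [measure_eq_zero_iff_ae_notMem.1 h0, ae_path_zero (shift (X m) ω),
    hΓ.ae_path hXΓ] with Y hY hY0 hYΓ
  refine Set.indicator_of_notMem (fun hmem => hY ⟨fun j => ?_, fun k => hΓG (hYΓ k)⟩) _
  have := hmem (m + j) (Nat.le_add_right _ _)
  cases j with
  | zero => simpa [splice, hY0] using this
  | succ j => simpa [splice] using this

theorem bddAbove_varDist {Ω : Type*} [MeasurableSpace Ω] (μ ν : Measure Ω)
    [IsProbabilityMeasure μ] (𝔪 : MeasurableSpace Ω) :
    BddAbove (Set.range fun A : {A : Set Ω // MeasurableSet[𝔪] A} => μ.real A.1 - ν.real A.1) :=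
  ⟨1, Set.forall_mem_range.2 fun A => by
    have h1 : μ.real A.1 ≤ 1 := measureReal_le_one
    have h2 : 0 ≤ ν.real A.1 := measureReal_nonneg
    linarith⟩

/-- A future event that holds almost surely in equilibrium, together with a step-closed set of
environments, holds almost surely for the i.i.d. environment. -/
theorem IsEquilibrium.ae_mem_of_ae_mem {d : ℕ} {u : Site d} {P Pinf : Measure (Env d)}
    (hP : IsIIDProduct P) (hN : HypothesisN u P) (hM : HypothesisM P)
    (hPinf : IsEquilibrium u P Pinf) {G : Set (Env d)} (hGm : MeasurableSet G)
    (hG : FutureSet u G) (h : ∀ᵐ ω ∂Pinf, ω ∈ G) : ∀ᵐ ω ∂P, ω ∈ G := by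
  have := hP.isProbabilityMeasure
  have := hPinf.prob
  by_contra hcon
  have hlt : P G < 1 := lt_of_le_of_ne prob_le_one fun h1 =>
    hcon ((mem_ae_iff_prob_eq_one hGm).2 h1)
  have hzero := hP.ae_shift (hP.ae_pathLaw_seen_eq_zero (ae_transient hP.stepStable hN hM)
    hGm hG hlt)
  obtain ⟨Γ, hΓ, hΓG, hcl⟩ := hPinf.stepStable.exists_stepClosed h
  have hone : ∀ ℓ : ℤ, Pinf (trapped u ℓ G) = 1 := fun ℓ => by
    rw [← mem_ae_iff_prob_eq_one (measurableSet_trapped u ℓ hGm)]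
    filter_upwards [hΓ, ae_transient hPinf.stepStable hPinf.hypN hPinf.hypM] with ω hω htr
    exact mem_trapped ℓ hcl hΓG hω htr
  have hnull : ∀ ℓ : ℤ, P (trapped u ℓ G) = 0 := fun ℓ => by
    rw [measure_eq_zero_iff_ae_notMem]
    filter_upwards [hzero] with ω hω
    rintro ⟨z, hz⟩
    exact hz (measure_mono_null Set.inter_subset_right (hω z))
  obtain ⟨c, C, hc, hC, hvar⟩ := hPinf.variation
  -- The event `trapped u ℓ G` alone makes the variation distance on `𝔖_ℓ` at least `1`.
  have hle : ∀ ℓ : ℕ, 1 ≤ C * Real.exp (-c * ℓ) := fun ℓ => by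
    have hm : MeasurableSet[futureSigma u ℓ] (trapped u ℓ G) :=
      localSigma_halfSpace_le u ℓ _ (measurableSet_of_local (measurableSet_trapped u ℓ hGm)
        fun ω ω' h => trapped_local u ℓ hGm hG h)
    have := le_ciSup (bddAbove_varDist Pinf P (futureSigma u ℓ)) ⟨trapped u ℓ G, hm⟩
    simp only [Measure.real, hone, hnull, ENNReal.toReal_one, ENNReal.toReal_zero, sub_zero] at this
    exact this.trans (hvar ℓ)
  have hlim : Tendsto (fun ℓ : ℕ => C * Real.exp (-c * ℓ)) atTop (𝓝 (C * 0)) := by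
    refine Tendsto.const_mul C (Real.tendsto_exp_atBot.comp ?_)
    exact tendsto_natCast_atTop_atTop.const_mul_atTop_of_neg (neg_neg_of_pos hc)
  have := ge_of_tendsto' hlim hle
  linarith

/-! ### The half-space convergence event and the conclusion -/

/-- Quenched convergence of the test functions over the paths that never go below level `0`. -/
def convSet {d : ℕ} (u : Site d) (v : Space d) (w : Finset (ℕ × ℕ) × ℕ → ℝ≥0∞) : Set (Env d) :=
  {ω | ∀ i, ConvOn (fun n X => testFun i (scaledPath v n X).1) (w i) ω (stay (halfSpace u 0))}

theorem measurableSet_convSet {d : ℕ} (u : Site d) (v : Space d)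
    (w : Finset (ℕ × ℕ) × ℕ → ℝ≥0∞) : MeasurableSet (convSet u v w) := by
  have : convSet u v w = ⋂ i, {ω | ConvOn (fun n X => testFun i (scaledPath v n X).1) (w i) ω
      (stay (halfSpace u 0))} := by
    ext ω; simp [convSet]
  rw [this]
  have hs := measurableSet_stay (halfSpace u 0)
  refine MeasurableSet.iInter fun i => measurableSet_tendsto_fun (fun n => ?_)
    ((measurable_pathLaw hs).const_mul (w i))
  simp only [← lintegral_indicator hs]
  exact ((measurable_testFun_scaledPath v i n).ennreal_ofReal.indicator hs).lintegral_kernel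
    (κ := pathKernel d)

/-- Both sides of the limit involve the path law only through its restriction to `stay (halfSpace u
0)`, which ignores the environment below level `0`. -/
theorem futureSet_convSet {d : ℕ} (u : Site d) (v : Space d) (w : Finset (ℕ × ℕ) × ℕ → ℝ≥0∞) :
    FutureSet u (convSet u v w) := by
  intro ω ω' h
  refine forall_congr' fun i => ?_
  have hr := restrict_stay_congr (halfSpace u 0) h
  have hu : pathLaw ω (stay (halfSpace u 0)) = pathLaw ω' (stay (halfSpace u 0)) := by
    rw [← Measure.restrict_apply_univ, hr, Measure.restrict_apply_univ]
  unfold ConvOn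
  rw [hr, hu]

theorem integral_quenchedScaledLaw {d : ℕ} (v : Space d) (n : ℕ) (ω : Env d)
    (i : Finset (ℕ × ℕ) × ℕ) :
    ∫ f, testFun i f.1 ∂(quenchedScaledLaw v n ω : Measure (SkorohodSpace d)) =
      ∫ X, testFun i (scaledPath v n X).1 ∂pathLaw ω :=
  integral_map (continuous_scaledPath v n).measurable.aemeasurable
    (continuous_testFun i).measurable.aestronglyMeasurable

theorem convOn_univ_iff {d : ℕ} {φ : ℕ → (ℕ → Site d) → ℝ} (hφ : Forgetful φ) {r : ℝ}
    (hr : 0 ≤ r) (ω : Env d) :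
    ConvOn φ (ENNReal.ofReal r) ω Set.univ ↔
      Tendsto (fun n => ∫ X, φ n X ∂pathLaw ω) atTop (𝓝 r) := by
  have h1 : ∀ n, ∫⁻ X in Set.univ, ENNReal.ofReal (φ n X) ∂pathLaw ω =
      ENNReal.ofReal (∫ X, φ n X ∂pathLaw ω) := fun n => by
    rw [setLIntegral_univ]
    refine (ofReal_integral_eq_lintegral_ofReal ?_ (Eventually.of_forall (hφ.nonneg n))).symm
    exact Integrable.of_bound (hφ.measurable n).aestronglyMeasurable 1
      (Eventually.of_forall fun X => by
        rw [Real.norm_eq_abs, abs_of_nonneg (hφ.nonneg n X)]; exact hφ.le_one n X)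
  unfold ConvOn
  simp only [h1, measure_univ, mul_one]
  refine ⟨fun h => ?_, fun h => ENNReal.tendsto_ofReal h⟩
  have := (ENNReal.tendsto_toReal ENNReal.ofReal_ne_top).comp h
  rw [ENNReal.toReal_ofReal hr] at this
  refine this.congr fun n => ?_
  exact ENNReal.toReal_ofReal (integral_nonneg (hφ.nonneg n))

end RWRE

theorem lemma5p3 {d : ℕ} (u : RWRE.Site d) (hu : u ≠ 0)
    (P Pinf : Measure (RWRE.Env d))
    (hP : RWRE.IsIIDProduct P) (hN : RWRE.HypothesisN u P) (hM : RWRE.HypothesisM P)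
    (hPinf : RWRE.IsEquilibrium u P Pinf)
    (v : RWRE.Space d)
    (𝔇 : Matrix (Fin d) (Fin d) ℝ) (h𝔇 : 𝔇.PosSemidef)
    (W : ProbabilityMeasure (RWRE.SkorohodSpace d))
    (hW : RWRE.IsBrownianLaw 𝔇 (W : Measure (RWRE.SkorohodSpace d)))
    (h : ∀ᵐ ω ∂Pinf, Tendsto (fun n : ℕ => RWRE.quenchedScaledLaw v n ω) atTop (𝓝 W)) :
    ∀ᵐ ω ∂P, Tendsto (fun n : ℕ => RWRE.quenchedScaledLaw v n ω) atTop (𝓝 W) := by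
  let r : Finset (ℕ × ℕ) × ℕ → ℝ := fun i =>
    ∫ f, RWRE.testFun i f.1 ∂(W : Measure (RWRE.SkorohodSpace d))
  have hr : ∀ i, 0 ≤ r i := fun i => integral_nonneg fun f => RWRE.testFun_nonneg i _
  have hφ := RWRE.forgetful_testFun v
  let G : Set (RWRE.Env d) := RWRE.convSet u v fun i => ENNReal.ofReal (r i)
  have hG : ∀ᵐ ω ∂Pinf, ω ∈ G := by
    -- The exit decomposition needs convergence in the environments seen from the walk too, hence
    -- the step-closed set.
    obtain ⟨Γ, hΓ, hΓh, hcl⟩ := hPinf.stepStable.exists_stepClosed h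
    filter_upwards [hΓ] with ω hω i
    refine RWRE.ConvOn.stay (hφ i) ENNReal.ofReal_ne_top hcl (fun ω hω => ?_) _ hω
    rw [RWRE.convOn_univ_iff (hφ i) (hr i)]
    simpa only [RWRE.integral_quenchedScaledLaw] using RWRE.tendsto_integral_testFun (hΓh ω hω) i
  have hPG : ∀ᵐ ω ∂P, ω ∈ G := hPinf.ae_mem_of_ae_mem hP hN hM
    (RWRE.measurableSet_convSet u v _)
    (RWRE.futureSet_convSet u v _) hG
  -- The walk may attain its minimum at any site, so half-space convergence is used at all shifts of
  -- `ω` at once.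
  filter_upwards [hP.ae_shift hPG, RWRE.ae_transient hP.stepStable hN hM] with ω hω htr
  refine RWRE.tendsto_of_forall_testFun hW.continuous_paths fun i => ?_
  simp only [RWRE.integral_quenchedScaledLaw]
  rw [← RWRE.convOn_univ_iff (hφ i) (hr i)]
  exact RWRE.ConvOn.univ_of_stay (hφ i) ENNReal.ofReal_ne_top (fun z => hω z i) htr
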